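/- Let $s\ge 1$ and $N\ge 2$ be integers, $\alpha>1/2$ and $\boldsymbol\gamma=(\gamma_1,\dots,\gamma_s)$ with all $\gamma_j>0$. For $h\in\mathbb Z$ and $\gamma>0$ put $r_{\alpha,\gamma}(0)=1$ and $r_{\alpha,\gamma}(h)=\gamma|h|^{-2\alpha}$ for $h\ne0$. On $[0,1]^s$ consider the half-period cosine kernel and the Korobov kernel $$K^{\cos}_{\alpha,\boldsymbol\gamma,s}(\boldsymbol x,\boldsymbol y)=\prod_{j=1}^s\Big(1+\sum_{k=1}^\infty r_{\alpha,\gamma_j}(k)\,\sqrt2\cos(\pi kx_j)\,\sqrt2\cos(\pi ky_j)\Big),\qquad K^{\rm kor}_{\alpha,\boldsymbol\gamma,s}(\boldsymbol x,\boldsymbol y)=\prod_{j=1}^s\sum_{h\in\mathbb Z}r_{\alpha,\gamma_j}(h)\,e^{2\pi i h(x_j-y_j)} .$$ For a reproducing kernel $K$ on $[0,1]^s$ let $\mathcal H(K)$ be its (real) reproducing kernel Hilbert space, and for points $P=(\boldsymbol x_0,\dots,\boldsymbol x_{N-1})$ let $$e(\mathcal H(K);P)=\sup_{f\in\mathcal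 H(K),\ \|f\|_K\le1}\Big|\int_{[0,1]^s}f(\boldsymbol x)\,d\boldsymbol x-\frac1N\sum_{n=0}^{N-1}f(\boldsymbol x_n)\Big| .$$ For $\boldsymbol g\in\{1,\dots,N-1\}^s$ let $P(\boldsymbol g,N)$ consist of the points $\{n\boldsymbol g/N\}$, $0\le n<N$ (componentwise fractional parts), and let $P_\phi(\boldsymbol g,N)$ consist of their images under the tent transformation $\phi(x)=1-|2x-1|$, applied componentwise. The component-by-component construction chooses $g_1,g_2,\dots,g_s$ one after the other: given $g_1,\dots,g_{d-1}$, the component $g_d\in\{1,\dots,N-1\}$ is chosen so as to minimize a quality criterion for $(g_1,\dots,g_d)$ (ties are broken arbitrarily). The criterion is either the worst-case error of the lattice rule in the Korobov space, $e(\mathcal H(K^{\rm kor}_{\alpha,(\gamma_1,\dots,\gamma_d),d});P((g_1,\dots,g_d),N))$, which is the one used by the fast version of the algorithm, or the worst-case error of the tent-transformed rule, $e(\mathcal H(K^{\cos}_{\alpha,(\gamma_1,\dots,\gamma_d),d});P_\phi((g_1,\dots,g_d),N))$. With either criterion such a vector $\boldsymbol g$ exists, and every vector $\boldsymbol g\in\{1,\dots,N-1\}^s$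 constructed in this way satisfies, simultaneously for all real $\tau$ with $1\le\tau<2\alpha$, $$e(\mathcal H(K^{\cos}_{\alpha,\boldsymbol\gamma,s});P_\phi(\boldsymbol g,N))\le C_{\alpha,\boldsymbol\gamma,s,\tau}\,(N-1)^{-\tau/2},$$ where the constant $C_{\alpha,\boldsymbol\gamma,s,\tau}>0$ is given, with $\gamma_{\mathfrak u}=\prod_{j\in\mathfrak u}\gamma_j$ and the Riemann zeta function $\zeta$, by $$C_{\alpha,\boldsymbol\gamma,s,\tau}=\Big(\sum_{\emptyset\ne\mathfrak u\subseteq\{1,\dots,s\}}\gamma_{\mathfrak u}^{1/\tau}\,(2\zeta(2\alpha/\tau))^{|\mathfrak u|}\Big)^{\tau/2}=\Big(-1+\prod_{j=1}^s\big(1+2\zeta(2\alpha/\tau)\gamma_j^{1/\tau}\big)\Big)^{\tau/2}.$$ -/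

import Mathlib

open scoped ENNReal unitInterval

noncomputable section

namespace TentLattice

/-! ### Positive semidefinite real kernels -/

/-- A real kernel `K : X × X → ℝ`, seen as an operator-valued matrix as in Mathlib's theory of
reproducing kernel Hilbert spaces. -/
def kernelMatrix {X : Type*} (K : X → X → ℝ) : Matrix X X (ℝ →L[ℝ] ℝ) :=
  Matrix.of fun x y => K x y • ContinuousLinearMap.id ℝ ℝ

/-- Symmetric positive semidefinite kernels. -/
def IsPSDKernel {X : Type*} (K : X → X → ℝ) : Prop :=
  (∀ x y, K x y = K y x) ∧
    ∀ (t : Finset X) (c : X → ℝ), 0 ≤ ∑ x ∈ t, ∑ y ∈ t, c x * c y * K x y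

theorem IsPSDKernel.posSemidef {X : Type*} {K : X → X → ℝ} (h : IsPSDKernel K) :
    (kernelMatrix K).PosSemidef := by
  have key := (RKHS.posSemidef_tfae (K := kernelMatrix K)).out 0 2
  refine key.mpr (And.intro ?_ fun v => ?_)
  · ext x y
    have hid : ContinuousLinearMap.adjoint (ContinuousLinearMap.id ℝ ℝ) =
        ContinuousLinearMap.id ℝ ℝ := star_one (ℝ →L[ℝ] ℝ)
    simp [kernelMatrix, ContinuousLinearMap.star_eq_adjoint, h.1 x y, hid]
  · have := h.2 v.support v
    simp only [kernelMatrix, Finsupp.sum, Matrix.of_apply]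
    refine this.trans (le_of_eq ?_)
    simp only [RCLike.re_to_real]
    refine Finset.sum_congr rfl fun x _ => Finset.sum_congr rfl fun y _ => ?_
    simp [h.1 y x]
    ring

/-- Kernels whose pointwise product with every positive semidefinite kernel is positive
semidefinite (auxiliary, for the proofs that the kernels below are positive semidefinite). -/
def IsSchurKernel {X : Type*} (K : X → X → ℝ) : Prop :=
  ∀ L : X → X → ℝ, IsPSDKernel L → IsPSDKernel fun x y => L x y * K x y

theorem isPSDKernel_one {X : Type*} : IsPSDKernel fun _ _ : X => (1 : ℝ) := by
  refine ⟨fun _ _ => rfl, fun t c => ?_⟩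
  have : ∑ x ∈ t, ∑ y ∈ t, c x * c y * (1 : ℝ) = (∑ x ∈ t, c x) * ∑ y ∈ t, c y := by
    simp [Finset.sum_mul_sum]
  rw [this]
  exact mul_self_nonneg _

theorem isSchurKernel_feature {X : Type*} {a : ℝ} (ha : 0 ≤ a) (p : X → ℝ) :
    IsSchurKernel fun x y => a * (p x * p y) := by
  refine fun L hL => ⟨fun x y => by simp only [hL.1 x y]; ring, fun t c => ?_⟩
  have := mul_nonneg ha (hL.2 t fun x => c x * p x)
  refine this.trans (le_of_eq ?_)
  simp only [Finset.mul_sum]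
  refine Finset.sum_congr rfl fun x _ => Finset.sum_congr rfl fun y _ => ?_
  ring

theorem IsSchurKernel.add {X : Type*} {K K' : X → X → ℝ} (h : IsSchurKernel K)
    (h' : IsSchurKernel K') : IsSchurKernel fun x y => K x y + K' x y := by
  refine fun L hL => ⟨fun x y => ?_, fun t c => ?_⟩
  · simp only [mul_add]
    exact congrArg₂ (· + ·) ((h L hL).1 x y) ((h' L hL).1 x y)
  · refine (add_nonneg ((h L hL).2 t c) ((h' L hL).2 t c)).trans (le_of_eq ?_)
    simp only [← Finset.sum_add_distrib, mul_add]

theorem IsSchurKernel.hasSum {X ι : Type*} {F : ι → X → X → ℝ} {K : X → X → ℝ}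
    (h : ∀ i, IsSchurKernel (F i)) (hs : ∀ x y, HasSum (fun i => F i x y) (K x y)) :
    IsSchurKernel K := by
  refine fun L hL => ⟨fun x y => ?_, fun t c => ?_⟩
  · refine ((hs x y).mul_left (L x y)).unique ?_
    have := (hs y x).mul_left (L y x)
    refine this.congr_fun fun i => ?_
    exact (h i L hL).1 x y
  · have : HasSum (fun i => ∑ x ∈ t, ∑ y ∈ t, c x * c y * (L x y * F i x y))
        (∑ x ∈ t, ∑ y ∈ t, c x * c y * (L x y * K x y)) :=
      hasSum_sum fun x _ => hasSum_sum fun y _ => ((hs x y).mul_left _).mul_left _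
    exact this.nonneg fun i => (h i L hL).2 t c

theorem IsSchurKernel.one_isPSD {X : Type*} {K : X → X → ℝ} (h : IsSchurKernel K) :
    IsPSDKernel K := by
  simpa using h _ isPSDKernel_one

theorem IsSchurKernel.prod {X ι : Type*} (t : Finset ι) {F : ι → X → X → ℝ}
    (h : ∀ i, IsSchurKernel (F i)) : IsPSDKernel fun x y => ∏ i ∈ t, F i x y := by
  classical
  induction t using Finset.induction_on with
  | empty => simpa using isPSDKernel_one
  | insert i t hi ih =>
    have := h i _ ih
    simpa [Finset.prod_insert hi, mul_comm] using this

/-! ### Worst-case error of quasi-Monte Carlo rules -/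

/-- The worst-case error `e(H(K); P)` of the equal-weight rule with nodes `P 0, …, P (N - 1)`
(counted with multiplicity) in the reproducing kernel Hilbert space `H(K)` of functions
`[0,1]^s → ℝ`. -/
def worstCaseError {s N : ℕ} (K : (Fin s → I) → (Fin s → I) → ℝ) (hK : IsPSDKernel K)
    (P : Fin N → Fin s → I) : ℝ≥0∞ :=
  haveI : Fact (kernelMatrix K).PosSemidef := ⟨hK.posSemidef⟩
  ⨆ (f : RKHS.OfKernel (kernelMatrix K)) (_ : ‖f‖ ≤ 1),
    ENNReal.ofReal |(∫ x : Fin s → I, f x) - (1 / (N : ℝ)) * ∑ n : Fin N, f (P n)|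

/-! ### The Korobov kernel and the half-period cosine kernel -/

/-- `r_{α,γ}(h) = 1` for `h = 0` and `γ |h| ^ (-2α)` otherwise. -/
def r (α γ : ℝ) (h : ℤ) : ℝ := if h = 0 then 1 else γ * |(h : ℝ)| ^ (-(2 * α))

/-- The one-dimensional Korobov kernel (its values are real). -/
def korKernel₁ (α γ : ℝ) (x y : I) : ℝ :=
  (∑' h : ℤ, (r α γ h : ℂ) *
    Complex.exp (2 * Real.pi * Complex.I * h * ((x : ℝ) - (y : ℝ)))).re

/-- The one-dimensional half-period cosine kernel. -/
def cosKernel₁ (α γ : ℝ) (x y : I) : ℝ :=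
  1 + ∑' k : ℕ, r α γ ((k : ℤ) + 1) *
    (√2 * Real.cos (Real.pi * (k + 1) * x)) * (√2 * Real.cos (Real.pi * (k + 1) * y))

def korKernel {s : ℕ} (α : ℝ) (γ : Fin s → ℝ) (x y : Fin s → I) : ℝ :=
  ∏ j, korKernel₁ α (γ j) (x j) (y j)

def cosKernel {s : ℕ} (α : ℝ) (γ : Fin s → ℝ) (x y : Fin s → I) : ℝ :=
  ∏ j, cosKernel₁ α (γ j) (x j) (y j)

theorem r_nonneg {α γ : ℝ} (hγ : 0 < γ) (h : ℤ) : 0 ≤ r α γ h := by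
  unfold r
  split_ifs
  · exact zero_le_one
  · positivity

theorem summable_r {α γ : ℝ} (hα : 1 / 2 < α) : Summable (r α γ) := by
  have h1 : Summable fun h : ℤ => γ * |(h : ℝ)| ^ (-(2 * α)) :=
    (Real.summable_abs_int_rpow (b := 2 * α) (by linarith)).mul_left γ
  refine (summable_congr_cofinite ?_).mpr h1
  refine Filter.mem_of_superset (Set.finite_singleton (0 : ℤ)).compl_mem_cofinite fun h hh => ?_
  simp only [Set.mem_compl_iff, Set.mem_singleton_iff] at hh
  simp [r, hh]

theorem isSchurKernel_korKernel₁ {X : Type*} {α γ : ℝ} (hα : 1 / 2 < α) (hγ : 0 < γ)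
    (q : X → I) : IsSchurKernel fun x y => korKernel₁ α γ (q x) (q y) := by
  refine IsSchurKernel.hasSum (ι := ℤ) (F := fun h x y =>
    r α γ h * (Real.cos (2 * Real.pi * h * q x) * Real.cos (2 * Real.pi * h * q y)) +
    r α γ h * (Real.sin (2 * Real.pi * h * q x) * Real.sin (2 * Real.pi * h * q y)))
    (fun h => (isSchurKernel_feature (r_nonneg hγ h) _).add
      (isSchurKernel_feature (r_nonneg hγ h) _)) fun x y => ?_
  have key : ∀ h : ℤ, Complex.exp (2 * Real.pi * Complex.I * h * ((q x : ℝ) - (q y : ℝ))) =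
      Complex.exp (((2 * Real.pi * h * ((q x : ℝ) - (q y : ℝ)) : ℝ) : ℂ) * Complex.I) := by
    intro h
    congr 1
    push_cast
    ring
  have hs : Summable fun h : ℤ => (r α γ h : ℂ) *
      Complex.exp (2 * Real.pi * Complex.I * h * ((q x : ℝ) - (q y : ℝ))) := by
    refine Summable.of_norm_bounded (summable_r (γ := γ) hα) fun h => ?_
    rw [key, norm_mul, Complex.norm_exp_ofReal_mul_I, mul_one, Complex.norm_real,
      Real.norm_of_nonneg (r_nonneg hγ h)]
  refine (Complex.hasSum_re hs.hasSum).congr_fun fun h => ?_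
  rw [key, Complex.re_ofReal_mul, Complex.exp_ofReal_mul_I_re, mul_sub, Real.cos_sub]
  ring

theorem isSchurKernel_cosKernel₁ {X : Type*} {α γ : ℝ} (hα : 1 / 2 < α) (hγ : 0 < γ)
    (q : X → I) : IsSchurKernel fun x y => cosKernel₁ α γ (q x) (q y) := by
  have h1 : IsSchurKernel fun _ _ : X => (1 : ℝ) := fun L hL => by simpa using hL
  refine h1.add (IsSchurKernel.hasSum (ι := ℕ) (F := fun k x y => r α γ ((k : ℤ) + 1) *
    ((√2 * Real.cos (Real.pi * (k + 1) * q x)) * (√2 * Real.cos (Real.pi * (k + 1) * q y))))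
    (fun k => isSchurKernel_feature (r_nonneg hγ _) _) fun x y => ?_)
  have hr : Summable fun k : ℕ => r α γ ((k : ℤ) + 1) :=
    (summable_r (γ := γ) hα).comp_injective (i := fun k : ℕ => (k : ℤ) + 1)
      fun a b h => by simpa using h
  have hs : Summable fun k : ℕ => r α γ ((k : ℤ) + 1) *
      (√2 * Real.cos (Real.pi * (k + 1) * q x)) * (√2 * Real.cos (Real.pi * (k + 1) * q y)) := by
    refine Summable.of_norm_bounded (hr.mul_right 2) fun k => ?_
    have hc := mul_le_one₀ (Real.abs_cos_le_one (Real.pi * (k + 1) * q x)) (abs_nonneg _)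
      (Real.abs_cos_le_one (Real.pi * (k + 1) * q y))
    have h2 : √(2 : ℝ) * √2 = 2 := Real.mul_self_sqrt (by norm_num)
    have : ‖r α γ ((k : ℤ) + 1) * (√2 * Real.cos (Real.pi * (k + 1) * q x)) *
        (√2 * Real.cos (Real.pi * (k + 1) * q y))‖ = r α γ ((k : ℤ) + 1) * (√2 * √2 *
          (|Real.cos (Real.pi * (k + 1) * q x)| * |Real.cos (Real.pi * (k + 1) * q y)|)) := by
      simp only [norm_mul, Real.norm_eq_abs, abs_of_nonneg (r_nonneg (α := α) hγ ((k : ℤ) + 1)),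
        abs_of_nonneg (Real.sqrt_nonneg 2)]
      ring
    rw [this, h2]
    exact mul_le_mul_of_nonneg_left (by linarith) (r_nonneg hγ _)
  exact hs.hasSum.congr_fun fun k => by ring

theorem isPSDKernel_korKernel {s : ℕ} {α : ℝ} (hα : 1 / 2 < α) {γ : Fin s → ℝ}
    (hγ : ∀ j, 0 < γ j) : IsPSDKernel (korKernel α γ) :=
  IsSchurKernel.prod Finset.univ
    (F := fun j (x y : Fin s → I) => korKernel₁ α (γ j) (x j) (y j))
    fun j => isSchurKernel_korKernel₁ hα (hγ j) fun x : Fin s → I => x j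

theorem isPSDKernel_cosKernel {s : ℕ} {α : ℝ} (hα : 1 / 2 < α) {γ : Fin s → ℝ}
    (hγ : ∀ j, 0 < γ j) : IsPSDKernel (cosKernel α γ) :=
  IsSchurKernel.prod Finset.univ
    (F := fun j (x y : Fin s → I) => cosKernel₁ α (γ j) (x j) (y j))
    fun j => isSchurKernel_cosKernel₁ hα (hγ j) fun x : Fin s → I => x j

/-! ### Lattice rules and tent-transformed lattice rules -/

/-- The lattice points `{n g / N}`, `0 ≤ n < N`. -/
def latticePoints {s : ℕ} (g : Fin s → ℕ) (N : ℕ) (n : Fin N) (j : Fin s) : I :=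
  ⟨Int.fract ((n : ℝ) * (g j : ℝ) / (N : ℝ)), unitInterval.fract_mem _⟩

/-- The tent transformation `φ(x) = 1 - |2x - 1|`. -/
def tent (x : I) : I :=
  ⟨1 - |2 * (x : ℝ) - 1|, by
    have h : |2 * (x : ℝ) - 1| ≤ 1 := abs_le.mpr ⟨by linarith [x.2.1], by linarith [x.2.2]⟩
    exact ⟨by linarith, by linarith [abs_nonneg (2 * (x : ℝ) - 1)]⟩⟩

/-- The tent-transformed lattice points. -/
def tentLatticePoints {s : ℕ} (g : Fin s → ℕ) (N : ℕ) (n : Fin N) (j : Fin s) : I :=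
  tent (latticePoints g N n j)

/-- `e(H(K^kor_{α,γ,s}); P(g,N))`. -/
def korError {s : ℕ} (N : ℕ) {α : ℝ} (hα : 1 / 2 < α) {γ : Fin s → ℝ} (hγ : ∀ j, 0 < γ j)
    (g : Fin s → ℕ) : ℝ≥0∞ :=
  worstCaseError (korKernel α γ) (isPSDKernel_korKernel hα hγ) (latticePoints g N)

/-- `e(H(K^cos_{α,γ,s}); P_φ(g,N))`. -/
def cosError {s : ℕ} (N : ℕ) {α : ℝ} (hα : 1 / 2 < α) {γ : Fin s → ℝ} (hγ : ∀ j, 0 < γ j)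
    (g : Fin s → ℕ) : ℝ≥0∞ :=
  worstCaseError (cosKernel α γ) (isPSDKernel_cosKernel hα hγ) (tentLatticePoints g N)

/-! ### Component-by-component construction -/

/-- `g` is an output of the component-by-component algorithm with quality criterion `err`
(`err d _ z` is the criterion for a `d`-dimensional generating vector `z`): one component after
the other is chosen in `{1, …, N - 1}`, the preceding ones being kept fixed, so as to minimize the
criterion in the current dimension. Ties may be broken in any way. -/
def IsCBC (s N : ℕ) (err : (d : ℕ) → d ≤ s → (Fin d → ℕ) → ℝ≥0∞) (g : Fin s → ℕ) : Prop :=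
  ∀ (d : ℕ) (hd : d < s), g ⟨d, hd⟩ ∈ Finset.Icc 1 (N - 1) ∧
    ∀ z ∈ Finset.Icc 1 (N - 1),
      err (d + 1) hd (fun i => g (Fin.castLE hd i)) ≤
        err (d + 1) hd (Fin.snoc (α := fun _ => ℕ) (fun i : Fin d => g (Fin.castLE hd.le i)) z)

/-- Component-by-component construction with the worst-case error of the lattice rule in the
Korobov space as criterion (the criterion evaluated by the fast algorithm). -/
def IsKorCBC {s : ℕ} (N : ℕ) {α : ℝ} (hα : 1 / 2 < α) {γ : Fin s → ℝ} (hγ : ∀ j, 0 < γ j)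
    (g : Fin s → ℕ) : Prop :=
  IsCBC s N (fun _ h => korError N hα (γ := fun j => γ (Fin.castLE h j)) fun _ => hγ _) g

/-- Component-by-component construction with the worst-case error of the tent-transformed lattice
rule in the half-period cosine space as criterion. -/
def IsCosCBC {s : ℕ} (N : ℕ) {α : ℝ} (hα : 1 / 2 < α) {γ : Fin s → ℝ} (hγ : ∀ j, 0 < γ j)
    (g : Fin s → ℕ) : Prop :=
  IsCBC s N (fun _ h => cosError N hα (γ := fun j => γ (Fin.castLE h j)) fun _ => hγ _) g

/-! ### The constant -/

/-- The Riemann zeta function at a real argument (real-valued there). -/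
def zetaReal (x : ℝ) : ℝ := (riemannZeta (x : ℂ)).re

/-- `C_{α,γ,s,τ}`, as a sum over the nonempty subsets of `{1, …, s}`,
with `γ_u = ∏_{j ∈ u} γ_j`. -/
def boundConst {s : ℕ} (α : ℝ) (γ : Fin s → ℝ) (τ : ℝ) : ℝ :=
  (∑ u : Finset (Fin s) with u.Nonempty,
    (∏ j ∈ u, γ j) ^ (1 / τ) * (2 * zetaReal (2 * α / τ)) ^ u.card) ^ (τ / 2)

end TentLattice

end

/-!
On the points of a rank-one lattice every cosine `cos (2 π h x_j)` depends on `h` modulo `N` only,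
and the tent transformation turns the half-period cosines into these; so, after folding the
weights `r` to the residues modulo `N`, both squared worst-case errors plus one are averages over
`m` of the weight of the dual lattice of `g`, damped by factors `φ (c_j m g_j)`: with `φ = 1` for
the lattice rule in the Korobov space, and with `φ = cos (2 π · / N)` for the tent-transformed
rule. As `|φ| ≤ 1`, the first dominates the second.

A new component `g_d` increases such an error by at most `∑_{h ≠ 0} γ_d |h|^{-2α} W(h g_d)`, where
`W(c)` is the weight of the frequencies congruent to `c`. After raising it to the power
`p = 1/τ ≤ 1`, which is subadditive, the increment has to be averaged over the
`g_d ∈ {1, …, N - 1}`. Since `N` need not be prime, the plain mean is too large; a nonnegative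
weighted mean obtained by sieving over the divisors of `N` is bounded by `2 ζ(2αp) γ_d^p` times
`∑ W / (N - 1)`. The minimizing component does at least as well, and the product formula follows
by induction.
-/

noncomputable section

namespace TentLattice

section Sieve

open scoped ArithmeticFunction.Moebius

theorem sum_divisors_moebius_eq_ite {n : ℕ} :
    ∑ d ∈ n.divisors, (μ d : ℝ) = if n = 1 then 1 else 0 := by
  rw [← ArithmeticFunction.one_apply, ← ArithmeticFunction.coe_moebius_mul_coe_zeta (R := ℝ),
    ArithmeticFunction.coe_mul_zeta_apply]
  rfl

theorem prod_primeFactors_one_sub {R : Type*} [CommRing R] {f : ArithmeticFunction R}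
    (hf : f.IsMultiplicative) {n : ℕ} (hn : n ≠ 0) :
    ∏ p ∈ n.primeFactors, (1 - f p) = ∑ d ∈ n.divisors, (μ d : R) * f d := by
  have hμf : ((μ : ArithmeticFunction R).pmul f).IsMultiplicative :=
    ArithmeticFunction.isMultiplicative_moebius.intCast.pmul hf
  suffices ArithmeticFunction.prodPrimeFactors (fun p => 1 - f p) =
      (μ : ArithmeticFunction R).pmul f * (ArithmeticFunction.zeta : ArithmeticFunction R) by
    rw [← ArithmeticFunction.prodPrimeFactors_apply hn, this,
      ArithmeticFunction.coe_mul_zeta_apply]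
    rfl
  refine (ArithmeticFunction.IsMultiplicative.eq_iff_eq_on_prime_powers _
    (ArithmeticFunction.IsMultiplicative.prodPrimeFactors _) _
    (hμf.mul ArithmeticFunction.isMultiplicative_zeta.natCast)).mpr fun p k hp => ?_
  rw [ArithmeticFunction.prodPrimeFactors_apply (pow_ne_zero k hp.ne_zero),
    ArithmeticFunction.coe_mul_zeta_apply, Nat.sum_divisors_prime_pow hp, Finset.sum_range_succ']
  rcases eq_or_ne k 0 with rfl | hk
  · simp [hf.map_one]
  · rw [Nat.primeFactors_prime_pow hk hp]
    simp [ArithmeticFunction.moebius_apply_prime_pow, hp, hf.map_one, Nat.pos_of_ne_zero hk,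
      neg_add_eq_sub]

/-- The sieve weight `∏_{p ∣ n} (1 - p^{1-a})`. At `n = gcd(g, N)` it is the weight of `g` in the
average over generators `g` modulo a composite `N`; generators sharing factors with `N` count
less. -/
def sieveWeight (a : ℝ) (n : ℕ) : ℝ := ∏ p ∈ n.primeFactors, (1 - (p : ℝ) ^ (1 - a))

variable {a : ℝ}

theorem sieveFactor_mem_Ioc (ha : 1 < a) {p : ℕ} (hp : p.Prime) :
    1 - (p : ℝ) ^ (1 - a) ∈ Set.Ioc 0 1 :=
  ⟨sub_pos.mpr (Real.rpow_lt_one_of_one_lt_of_neg (by exact_mod_cast hp.one_lt) (by linarith)),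
    sub_le_self _ (by positivity)⟩

theorem sieveWeight_pos (ha : 1 < a) (n : ℕ) : 0 < sieveWeight a n :=
  Finset.prod_pos fun _ hp => (sieveFactor_mem_Ioc ha (Nat.prime_of_mem_primeFactors hp)).1

theorem sieveWeight_anti (ha : 1 < a) {m n : ℕ} (hn : n ≠ 0) (hmn : m ∣ n) :
    sieveWeight a n ≤ sieveWeight a m := by
  have hfac : ∀ p ∈ n.primeFactors, 1 - (p : ℝ) ^ (1 - a) ∈ Set.Ioc 0 1 := fun p hp =>
    sieveFactor_mem_Ioc ha (Nat.prime_of_mem_primeFactors hp)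
  exact Finset.prod_le_prod_of_subset_of_le_one (Nat.primeFactors_mono hmn hn)
    (fun p hp => (hfac p hp).1.le) fun p hp _ => (hfac p hp).2

theorem sieveWeight_eq_sum_divisors (ha : a ≠ 1) {n : ℕ} (hn : n ≠ 0) :
    sieveWeight a n = ∑ d ∈ n.divisors, (μ d : ℝ) * (d : ℝ) ^ (1 - a) := by
  let f : ArithmeticFunction ℝ :=
    ⟨fun d => (d : ℝ) ^ (1 - a), by simp [Real.zero_rpow (sub_ne_zero.mpr ha.symm)]⟩
  have hf : f.IsMultiplicative :=
    ⟨by simp [f], fun {m n} _ => by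
      simp [f, Real.mul_rpow (Nat.cast_nonneg m) (Nat.cast_nonneg n)]⟩
  exact prod_primeFactors_one_sub hf hn

end Sieve

section Averaging

variable {a : ℝ} {N : ℕ}

/-- The sum `∑_{h ∈ ℤ} |h|^{-a} W(h g)` along the multiples of `g`. For `a > 1` the term `h = 0`
vanishes because `0 ^ (-a) = 0` in Mathlib. -/
def multiplesSum (a : ℝ) (W : ZMod N → ℝ) (g : ZMod N) : ℝ :=
  ∑' h : ℤ, |(h : ℝ)| ^ (-a) * W (h * g)

theorem multiplesSum_nonneg {W : ZMod N → ℝ} (hW : ∀ c, 0 ≤ W c) (g : ZMod N) :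
    0 ≤ multiplesSum a W g :=
  tsum_nonneg fun h => mul_nonneg (by positivity) (hW _)

variable [NeZero N]

theorem natCast_dvd_iff_dvd_val {d : ℕ} (hd : d ∣ N) (g : ZMod N) :
    (d : ZMod N) ∣ g ↔ d ∣ g.val := by
  refine ⟨?_, fun h => by simpa using map_dvd (Nat.castRingHom (ZMod N)) h⟩
  rintro ⟨b, rfl⟩
  rw [← ZMod.natCast_zmod_val b, ← Nat.cast_mul, ZMod.val_natCast,
    Nat.dvd_mod_iff hd]
  exact dvd_mul_right d _

theorem card_natCast_mul_eq {d : ℕ} (hd : d ∣ N) (g : ZMod N) :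
    Finset.card {b : ZMod N | (d : ZMod N) * b = g} = if d ∣ g.val then d else 0 := by
  split_ifs with h
  · obtain ⟨y, rfl⟩ := (natCast_dvd_iff_dvd_val hd g).mpr h
    have hker := IsAddCyclic.card_nsmulAddMonoidHom_ker (ZMod N) d
    rw [Nat.card_zmod, Nat.gcd_eq_right hd] at hker
    calc Finset.card {b : ZMod N | (d : ZMod N) * b = d * y}
        = Finset.card {b : ZMod N | (d : ZMod N) * b = 0} :=
          AddMonoidHom.card_fiber_eq_of_mem_range (AddMonoidHom.mulLeft (d : ZMod N))
            ⟨y, rfl⟩ ⟨0, by simp⟩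
      _ = Nat.card (nsmulAddMonoidHom d : ZMod N →+ ZMod N).ker := by
          simp [Nat.card_eq_fintype_card, Fintype.card_subtype, AddMonoidHom.mem_ker]
      _ = d := hker
  · rw [Finset.card_eq_zero, Finset.filter_eq_empty_iff]
    exact fun b _ hb => h ((natCast_dvd_iff_dvd_val hd g).mp ⟨b, hb.symm⟩)

theorem sum_natCast_mul {d : ℕ} (hd : d ∣ N) (G : ZMod N → ℝ) :
    ∑ b : ZMod N, G (d * b) = d * ∑ g : ZMod N with d ∣ g.val, G g := by
  rw [← Finset.sum_fiberwise Finset.univ fun b : ZMod N => (d : ZMod N) * b, Finset.sum_filter,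
    Finset.mul_sum]
  refine Finset.sum_congr rfl fun g _ => ?_
  rw [Finset.sum_congr rfl fun b hb => congrArg G (Finset.mem_filter.mp hb).2, Finset.sum_const,
    card_natCast_mul_eq hd, nsmul_eq_mul]
  split_ifs <;> simp

theorem summable_abs_rpow_mul (ha : 1 < a) {G : ℤ → ℝ} {B : ℝ} (hG : ∀ h, |G h| ≤ B) :
    Summable fun h : ℤ => |(h : ℝ)| ^ (-a) * G h := by
  refine Summable.of_norm_bounded ((Real.summable_abs_int_rpow ha).mul_right B) fun h => ?_
  rw [norm_mul, Real.norm_of_nonneg (by positivity), Real.norm_eq_abs]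
  exact mul_le_mul_of_nonneg_left (hG h) (by positivity)

theorem summable_abs_rpow_mul_comp_intCast (ha : 1 < a) (W : ZMod N → ℝ) :
    Summable fun h : ℤ => |(h : ℝ)| ^ (-a) * W h :=
  summable_abs_rpow_mul ha fun h =>
    Finset.single_le_sum (f := fun c => |W c|) (fun _ _ => abs_nonneg _)
      (Finset.mem_univ (h : ZMod N))

theorem sum_multiplesSum_of_dvd (ha : 1 < a) {d : ℕ} (hd : d ∣ N) (W : ZMod N → ℝ) :
    (d : ℝ) ^ (1 - a) * ∑ g : ZMod N with d ∣ g.val, multiplesSum a W g =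
      ∑' h : ℤ, if (d : ℤ) ∣ h then |(h : ℝ)| ^ (-a) * ∑ b, W (h * b) else 0 := by
  have hd0 : 0 < d := Nat.pos_of_dvd_of_pos hd (NeZero.pos N)
  have hinj : Function.Injective fun k : ℤ => (d : ℤ) * k :=
    mul_right_injective₀ (by exact_mod_cast hd0.ne')
  have hsupp : Function.support (fun h : ℤ =>
      if (d : ℤ) ∣ h then |(h : ℝ)| ^ (-a) * ∑ b, W (h * b) else 0) ⊆
        Set.range fun k : ℤ => (d : ℤ) * k := fun h hh => by
    obtain ⟨k, rfl⟩ : (d : ℤ) ∣ h := by_contra fun hn => hh (if_neg hn)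
    exact ⟨k, rfl⟩
  have hterm (b : ZMod N) (k : ℤ) :
      (d : ℝ) ^ (-a) * (|(k : ℝ)| ^ (-a) * W (k * (d * b))) =
        |((d * k : ℤ) : ℝ)| ^ (-a) * W ((d * k : ℤ) * b) := by
    push_cast
    rw [abs_mul, Nat.abs_cast, Real.mul_rpow (Nat.cast_nonneg d) (abs_nonneg _), mul_assoc,
      mul_left_comm (k : ZMod N), mul_assoc (d : ZMod N)]
  calc (d : ℝ) ^ (1 - a) * ∑ g : ZMod N with d ∣ g.val, multiplesSum a W g
      = ∑ b : ZMod N, (d : ℝ) ^ (-a) * multiplesSum a W (d * b) := by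
        rw [← Finset.mul_sum, sum_natCast_mul hd, sub_eq_neg_add,
          Real.rpow_add_one (by exact_mod_cast hd0.ne'), mul_assoc]
    _ = ∑ b : ZMod N, ∑' k : ℤ, |((d * k : ℤ) : ℝ)| ^ (-a) * W ((d * k : ℤ) * b) :=
        Finset.sum_congr rfl fun b _ => by
          rw [multiplesSum, ← tsum_mul_left]
          exact tsum_congr (hterm b)
    _ = ∑' k : ℤ, ∑ b : ZMod N, |((d * k : ℤ) : ℝ)| ^ (-a) * W ((d * k : ℤ) * b) := by
        refine (Summable.tsum_finsetSum fun b _ => ?_).symm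
        simp only [← hterm]
        exact (summable_abs_rpow_mul_comp_intCast ha fun c : ZMod N => W (c * (d * b))).mul_left _
    _ = _ := by
        rw [← hinj.tsum_eq hsupp]
        exact tsum_congr fun k => by rw [if_pos (dvd_mul_right _ k), Finset.mul_sum]

theorem divisors_gcd_eq_filter (m : ℕ) : (m.gcd N).divisors = {d ∈ N.divisors | d ∣ m} := by
  ext d
  simp [Nat.dvd_gcd_iff, NeZero.ne N, and_comm]

theorem sum_intCast_mul_of_coprime {h : ℤ} (hh : h.natAbs.Coprime N) (W : ZMod N → ℝ) :
    ∑ b : ZMod N, W (h * b) = ∑ b, W b := by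
  obtain ⟨u, hu⟩ : IsUnit (h : ZMod N) := (ZMod.coe_int_isUnit_iff_isCoprime h N).mpr
    (isCoprime_comm.mp (Int.isCoprime_iff_gcd_eq_one.mpr hh))
  rw [← Equiv.sum_comp (Units.mulLeft u) W]
  simp [hu]

open scoped ArithmeticFunction.Moebius in
/-- Möbius inversion over the common divisors of `h` and `N`: after multiplication by the sieve
weights, only the frequencies `h` coprime to `N` survive, and these permute `ZMod N`. -/
theorem sum_sieveWeight_mul_multiplesSum (ha : 1 < a) (W : ZMod N → ℝ) :
    ∑ g : ZMod N, sieveWeight a (g.val.gcd N) * multiplesSum a W g =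
      (∑' h : ℤ, if h.natAbs.Coprime N then |(h : ℝ)| ^ (-a) else 0) * ∑ b, W b := by
  set H : ℤ → ℝ := fun h => |(h : ℝ)| ^ (-a) * ∑ b, W (h * b)
  have hH : Summable H := summable_abs_rpow_mul_comp_intCast ha fun c => ∑ b, W (c * b)
  have hHd (d : ℕ) : Summable fun h : ℤ => if (d : ℤ) ∣ h then H h else 0 :=
    (hH.indicator {h : ℤ | (d : ℤ) ∣ h}).congr fun h => by simp [Set.indicator_apply]
  have hmoebius (h : ℤ) : ∑ d ∈ N.divisors, (μ d : ℝ) * (if (d : ℤ) ∣ h then H h else 0) =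
      if h.natAbs.Coprime N then H h else 0 := by
    simp only [Int.natCast_dvd, mul_ite, mul_zero]
    rw [← Finset.sum_filter, ← divisors_gcd_eq_filter, ← Finset.sum_mul,
      sum_divisors_moebius_eq_ite, ite_mul, one_mul, zero_mul]
  calc ∑ g : ZMod N, sieveWeight a (g.val.gcd N) * multiplesSum a W g
      = ∑ g : ZMod N, ∑ d ∈ N.divisors,
          if d ∣ g.val then (μ d : ℝ) * (d : ℝ) ^ (1 - a) * multiplesSum a W g else 0 :=
        Finset.sum_congr rfl fun g _ => by
          rw [sieveWeight_eq_sum_divisors ha.ne' (Nat.gcd_ne_zero_right (NeZero.ne N)),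
            divisors_gcd_eq_filter, Finset.sum_mul, Finset.sum_filter]
    _ = ∑ d ∈ N.divisors, (μ d : ℝ) *
          ((d : ℝ) ^ (1 - a) * ∑ g : ZMod N with d ∣ g.val, multiplesSum a W g) := by
        rw [Finset.sum_comm]
        refine Finset.sum_congr rfl fun d _ => ?_
        rw [← Finset.sum_filter, ← Finset.mul_sum, mul_assoc]
    _ = ∑ d ∈ N.divisors, (μ d : ℝ) * ∑' h : ℤ, if (d : ℤ) ∣ h then H h else 0 :=
        Finset.sum_congr rfl fun d hd => by
          rw [sum_multiplesSum_of_dvd ha (Nat.dvd_of_mem_divisors hd)]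
    _ = ∑' h : ℤ, if h.natAbs.Coprime N then H h else 0 := by
        simp only [← tsum_mul_left]
        rw [← Summable.tsum_finsetSum fun d _ => (hHd d).mul_left _]
        exact tsum_congr hmoebius
    _ = _ := by
        rw [← tsum_mul_right]
        refine tsum_congr fun h => ?_
        split_ifs with hh
        · simp only [H, sum_intCast_mul_of_coprime hh]
        · rw [zero_mul]

theorem exists_ne_card_sub_one_mul_le {ι : Type*} [Fintype ι] [Nontrivial ι] {v f : ι → ℝ}
    {i₀ : ι} {C : ℝ} (hv : ∀ i, 0 < v i) (hmin : ∀ i, v i₀ ≤ v i) (hf : 0 ≤ f i₀) (hC : 0 ≤ C)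
    (hsum : Fintype.card ι * ∑ i, v i * f i ≤ C * ∑ i, v i) :
    ∃ i, i ≠ i₀ ∧ ((Fintype.card ι : ℝ) - 1) * f i ≤ C := by
  classical
  set n : ℝ := (Fintype.card ι : ℝ)
  have hn : 1 < n := Nat.one_lt_cast.mpr (Fintype.one_lt_card (α := ι))
  set S : Finset ι := Finset.univ.erase i₀
  have hcard : (S.card : ℝ) = n - 1 := by
    rw [Finset.card_erase_of_mem (Finset.mem_univ i₀), Finset.card_univ,
      Nat.cast_sub Fintype.card_pos, Nat.cast_one]
  have hsplit (F : ι → ℝ) : ∑ i, F i = F i₀ + ∑ i ∈ S, F i :=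
    (Finset.add_sum_erase _ F (Finset.mem_univ i₀)).symm
  have hV : (n - 1) * ∑ i, v i ≤ n * ∑ i ∈ S, v i := by
    have hcard_mul := Finset.card_nsmul_le_sum S v (v i₀) fun i _ => hmin i
    rw [nsmul_eq_mul, hcard] at hcard_mul
    rw [hsplit]
    linarith
  have hS : S.Nonempty := by
    obtain ⟨i, hi⟩ := exists_ne i₀
    exact ⟨i, Finset.mem_erase.mpr ⟨hi, Finset.mem_univ i⟩⟩
  obtain ⟨i, hi, hle⟩ : ∃ i ∈ S, v i * (n * ((n - 1) * f i)) ≤ v i * (n * C) := by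
    refine Finset.exists_le_of_sum_le hS ?_
    calc ∑ i ∈ S, v i * (n * ((n - 1) * f i)) = (n - 1) * (n * ∑ i ∈ S, v i * f i) := by
          simp only [Finset.mul_sum]
          exact Finset.sum_congr rfl fun i _ => by ring
      _ ≤ (n - 1) * (n * ∑ i, v i * f i) := by
          have := mul_nonneg (hv i₀).le hf
          refine mul_le_mul_of_nonneg_left (mul_le_mul_of_nonneg_left ?_ ?_) ?_ <;>
            linarith [hsplit fun i => v i * f i]
      _ ≤ (n - 1) * (C * ∑ i, v i) := mul_le_mul_of_nonneg_left hsum (by linarith)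
      _ = C * ((n - 1) * ∑ i, v i) := by ring
      _ ≤ C * (n * ∑ i ∈ S, v i) := mul_le_mul_of_nonneg_left hV hC
      _ = ∑ i ∈ S, v i * (n * C) := by rw [← Finset.sum_mul]; ring
  exact ⟨i, Finset.ne_of_mem_erase hi,
    le_of_mul_le_mul_left (le_of_mul_le_mul_left hle (hv i)) (by linarith)⟩

theorem exists_ne_zero_multiplesSum_le [Nontrivial (ZMod N)] (ha : 1 < a) {W : ZMod N → ℝ}
    (hW : ∀ c, 0 ≤ W c) :
    ∃ g : ZMod N, g ≠ 0 ∧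
      ((N : ℝ) - 1) * multiplesSum a W g ≤ (∑' h : ℤ, |(h : ℝ)| ^ (-a)) * ∑ c, W c := by
  set v : ZMod N → ℝ := fun g => sieveWeight a (g.val.gcd N)
  have hmin (g : ZMod N) : v 0 ≤ v g := by
    simpa [v] using sieveWeight_anti ha (NeZero.ne N) (Nat.gcd_dvd_right g.val N)
  have hone := sum_sieveWeight_mul_multiplesSum ha fun _ : ZMod N => 1
  simp only [multiplesSum, mul_one, ← Finset.sum_mul, Finset.sum_const, Finset.card_univ,
    nsmul_eq_mul] at hone
  have hbound := exists_ne_card_sub_one_mul_le (fun g => sieveWeight_pos ha _) hmin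
    (multiplesSum_nonneg hW 0)
    (mul_nonneg (tsum_nonneg fun h : ℤ => by positivity : 0 ≤ ∑' h : ℤ, |(h : ℝ)| ^ (-a))
      (Finset.sum_nonneg fun c _ => hW c))
    (by
      rw [sum_sieveWeight_mul_multiplesSum ha W, mul_right_comm, mul_comm _ (∑ g, v g), hone]
      exact le_of_eq (by ring))
  rwa [ZMod.card] at hbound

end Averaging

section WorstCaseError

open MeasureTheory InnerProductSpace

theorem iSup_ofReal_abs_inner {H : Type*} [NormedAddCommGroup H] [InnerProductSpace ℝ H] (h : H) :
    ⨆ (f : H) (_ : ‖f‖ ≤ 1), ENNReal.ofReal |⟪f, h⟫_ℝ| = ENNReal.ofReal ‖h‖ := by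
  refine le_antisymm (iSup₂_le fun f hf => ENNReal.ofReal_le_ofReal ?_) ?_
  · exact (abs_real_inner_le_norm f h).trans (mul_le_of_le_one_left (norm_nonneg h) hf)
  · rcases eq_or_ne h 0 with rfl | h0
    · simp
    · have hnorm : ‖h‖ ≠ 0 := norm_ne_zero_iff.mpr h0
      refine le_iSup₂_of_le (‖h‖⁻¹ • h)
        (by rw [norm_smul, norm_inv, norm_norm, inv_mul_cancel₀ hnorm])
        (ENNReal.ofReal_le_ofReal ?_)
      rw [real_inner_smul_left, real_inner_self_eq_norm_sq, pow_two, inv_mul_cancel_left₀ hnorm]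
      exact le_abs_self _

theorem norm_integral_sub_average_sq {X H : Type*} [MeasurableSpace X] {μ : Measure X}
    [IsProbabilityMeasure μ] [NormedAddCommGroup H] [InnerProductSpace ℝ H] [CompleteSpace H]
    {k : X → H} (hk : Integrable k μ) (hone : ∀ x, ∫ y, ⟪k x, k y⟫_ℝ ∂μ = 1) {N : ℕ} (hN : N ≠ 0)
    (P : Fin N → X) :
    ‖∫ x, k x ∂μ - (1 / (N : ℝ)) • ∑ n, k (P n)‖ ^ 2 =
      (1 / (N : ℝ) ^ 2) * ∑ n, ∑ m, ⟪k (P n), k (P m)⟫_ℝ - 1 := by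
  have hkint (x : X) : ⟪k x, ∫ y, k y ∂μ⟫_ℝ = 1 := by rw [← integral_inner hk, hone]
  have hintint : ⟪∫ y, k y ∂μ, ∫ y, k y ∂μ⟫_ℝ = 1 := by
    rw [← integral_inner hk]
    simp only [real_inner_comm _ (∫ y, k y ∂μ), hkint]
    simp
  have hN0 : (N : ℝ) ≠ 0 := Nat.cast_ne_zero.mpr hN
  rw [norm_sub_sq_real, ← real_inner_self_eq_norm_sq, ← real_inner_self_eq_norm_sq, hintint,
    real_inner_smul_right, real_inner_smul_left, real_inner_smul_right, real_inner_comm, sum_inner,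
    sum_inner]
  simp only [inner_sum, hkint, Finset.sum_const, Finset.card_univ, Fintype.card_fin, nsmul_eq_mul]
  field_simp
  ring

theorem kerFun_ofKernel_inner {X : Type*} (K : X → X → ℝ) [Fact (kernelMatrix K).PosSemidef]
    (x y : X) :
    ⟪RKHS.kerFun (RKHS.OfKernel (kernelMatrix K)) x (1 : ℝ),
      RKHS.kerFun (RKHS.OfKernel (kernelMatrix K)) y (1 : ℝ)⟫_ℝ = K x y := by
  rw [RKHS.kerFun_inner, RKHS.kerFun_apply, RKHS.OfKernel.kernel_ofKernel]
  simp [kernelMatrix]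

theorem continuous_kerFun_ofKernel {X : Type*} [TopologicalSpace X] (K : X → X → ℝ)
    [Fact (kernelMatrix K).PosSemidef] (hc : Continuous fun p : X × X => K p.1 p.2) :
    Continuous fun x => RKHS.kerFun (RKHS.OfKernel (kernelMatrix K)) x (1 : ℝ) := by
  refine continuous_iff_continuousAt.mpr fun x => tendsto_iff_norm_sub_tendsto_zero.mpr ?_
  have hdist (y : X) : ‖RKHS.kerFun (RKHS.OfKernel (kernelMatrix K)) y (1 : ℝ) -
      RKHS.kerFun (RKHS.OfKernel (kernelMatrix K)) x (1 : ℝ)‖ =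
        √(K y y - 2 * K y x + K x x) := by
    rw [← Real.sqrt_sq (norm_nonneg _), norm_sub_sq_real, ← real_inner_self_eq_norm_sq,
      ← real_inner_self_eq_norm_sq, kerFun_ofKernel_inner, kerFun_ofKernel_inner,
      kerFun_ofKernel_inner]
  simp only [hdist]
  have hdiag : Continuous fun y => K y y := hc.comp (continuous_id.prodMk continuous_id)
  have hsec : Continuous fun y => K y x := hc.comp (continuous_id.prodMk continuous_const)
  have hsqrt : Continuous fun y => √(K y y - 2 * K y x + K x x) :=
    ((hdiag.sub (hsec.const_mul 2)).add_const _).sqrt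
  refine (hsqrt.tendsto x).trans_eq ?_
  ring_nf
  rw [Real.sqrt_zero]

theorem worstCaseError_eq {s N : ℕ} (hN : N ≠ 0) {K : (Fin s → I) → (Fin s → I) → ℝ}
    (hK : IsPSDKernel K) (hc : Continuous fun p : (Fin s → I) × (Fin s → I) => K p.1 p.2)
    (hone : ∀ x, ∫ y, K x y = 1) (P : Fin N → Fin s → I) :
    0 ≤ (1 / (N : ℝ) ^ 2) * ∑ n, ∑ m, K (P n) (P m) - 1 ∧
    worstCaseError K hK P =
      ENNReal.ofReal √((1 / (N : ℝ) ^ 2) * ∑ n, ∑ m, K (P n) (P m) - 1) := by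
  have : Fact (kernelMatrix K).PosSemidef := ⟨hK.posSemidef⟩
  set H := RKHS.OfKernel (kernelMatrix K)
  set k : (Fin s → I) → H := fun x => RKHS.kerFun H x (1 : ℝ)
  have hkint : Integrable k := (continuous_kerFun_ofKernel K hc).integrable_of_hasCompactSupport
    (HasCompactSupport.of_compactSpace k)
  have heval (f : H) (x : Fin s → I) : f x = ⟪f, k x⟫_ℝ := by
    rw [RKHS.inner_kerFun]
    simp
  have hnorm := norm_integral_sub_average_sq hkint
    (fun x => by simp only [k, H, kerFun_ofKernel_inner, hone]) hN P
  simp only [k, H, kerFun_ofKernel_inner] at hnorm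
  rw [← hnorm, Real.sqrt_sq (norm_nonneg _), ← iSup_ofReal_abs_inner]
  refine ⟨sq_nonneg _, iSup_congr fun f => iSup_congr fun _ => ?_⟩
  rw [inner_sub_right, real_inner_smul_right, inner_sum, ← integral_inner hkint]
  simp only [heval]
  rfl

end WorstCaseError

section Kernels

open MeasureTheory

theorem continuous_tsum_mul {ι X : Type*} [TopologicalSpace X] {w : ι → ℝ} (hw : Summable w)
    {F : ι → X → ℝ} (hF : ∀ i, Continuous (F i)) (hb : ∀ i x, |F i x| ≤ 1) :
    Continuous fun x => ∑' i, w i * F i x :=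
  continuous_tsum (fun i => continuous_const.mul (hF i)) hw.abs fun i x => by
    rw [norm_mul]
    exact mul_le_of_le_one_right (abs_nonneg _) (hb i x)

theorem integral_tsum_mul {ι X : Type*} [Countable ι] [MeasurableSpace X] {μ : Measure X}
    [IsFiniteMeasure μ] {w : ι → ℝ} (hw : Summable w) {F : ι → X → ℝ}
    (hF : ∀ i, AEStronglyMeasurable (F i) μ) (hb : ∀ i x, |F i x| ≤ 1) :
    ∫ x, ∑' i, w i * F i x ∂μ = ∑' i, w i * ∫ x, F i x ∂μ := by
  have hint (i : ι) : Integrable (fun x => w i * F i x) μ :=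
    (Integrable.of_bound (hF i) 1 (Filter.Eventually.of_forall (hb i))).const_mul _
  have hnorm (i : ι) (x : X) : ‖w i * F i x‖ ≤ |w i| := by
    rw [norm_mul]
    exact mul_le_of_le_one_right (abs_nonneg _) (hb i x)
  simp only [← integral_const_mul]
  refine (integral_tsum_of_summable_integral_norm hint
    ((hw.abs.mul_left (μ.real Set.univ)).of_nonneg_of_le
      (fun i => integral_nonneg fun x => norm_nonneg _) fun i => ?_)).symm
  refine (integral_mono (hint i).norm (integrable_const _) (hnorm i)).trans_eq ?_
  rw [integral_const, smul_eq_mul]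

theorem integral_cos_add_mul {b : ℝ} (hb : b ≠ 0) (a : ℝ) :
    ∫ y : I, Real.cos (a + b * y) = (Real.sin (a + b) - Real.sin a) / b := by
  rw [unitInterval.measurePreserving_coe.integral_comp unitInterval.measurableEmbedding_coe
    (fun t : ℝ => Real.cos (a + b * t)), integral_Icc_eq_integral_Ioc,
    ← intervalIntegral.integral_of_le zero_le_one, intervalIntegral.integral_comp_add_mul _ hb]
  simp [integral_cos, div_eq_inv_mul]

theorem integral_cos_two_pi_mul_sub {h : ℤ} (hh : h ≠ 0) (x : I) :
    ∫ y : I, Real.cos (2 * Real.pi * h * ((x : ℝ) - y)) = 0 := by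
  have hb : -(2 * Real.pi * h) ≠ 0 := by simp [Real.pi_ne_zero, hh]
  have hsin : Real.sin (2 * Real.pi * h * x + -(2 * Real.pi * h)) =
      Real.sin (2 * Real.pi * h * x) := by
    rw [← Real.sin_sub_int_mul_two_pi (2 * Real.pi * h * x) h]
    ring_nf
  have hint := integral_cos_add_mul hb (2 * Real.pi * h * x)
  rw [hsin, sub_self, zero_div] at hint
  rw [← hint]
  ring_nf

theorem integral_cos_mul_cos_pi_mul {h : ℤ} (hh : h ≠ 0) (x : I) :
    ∫ y : I, Real.cos (Real.pi * h * x) * Real.cos (Real.pi * h * y) = 0 := by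
  have hb : Real.pi * h ≠ 0 := by simp [Real.pi_ne_zero, hh]
  have hint := integral_cos_add_mul hb 0
  rw [zero_add, mul_comm Real.pi (h : ℝ), Real.sin_int_mul_pi, Real.sin_zero, sub_zero, zero_div,
    mul_comm (h : ℝ)] at hint
  simp only [zero_add] at hint
  rw [integral_const_mul, hint, mul_zero]

variable {α γ : ℝ}

theorem r_neg (h : ℤ) : r α γ (-h) = r α γ h := by
  simp [r]

theorem r_zero : r α γ 0 = 1 := if_pos rfl

theorem korKernel₁_eq_tsum (hα : 1 / 2 < α) (x y : I) :
    korKernel₁ α γ x y = ∑' h : ℤ, r α γ h * Real.cos (2 * Real.pi * h * ((x : ℝ) - y)) := by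
  have hexp (h : ℤ) : Complex.exp (2 * Real.pi * Complex.I * h * ((x : ℝ) - (y : ℝ))) =
      Complex.exp (((2 * Real.pi * h * ((x : ℝ) - (y : ℝ)) : ℝ) : ℂ) * Complex.I) := by
    push_cast
    ring_nf
  have hsum : Summable fun h : ℤ => (r α γ h : ℂ) *
      Complex.exp (2 * Real.pi * Complex.I * h * ((x : ℝ) - (y : ℝ))) := by
    refine Summable.of_norm_bounded (summable_r (γ := γ) hα).abs fun h => ?_
    rw [hexp, norm_mul, Complex.norm_exp_ofReal_mul_I, mul_one, Complex.norm_real,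
      Real.norm_eq_abs]
  rw [korKernel₁, Complex.re_tsum hsum]
  exact tsum_congr fun h => by rw [hexp, Complex.re_ofReal_mul, Complex.exp_ofReal_mul_I_re]

theorem abs_cos_mul_cos_le_one (a b : ℝ) : |Real.cos a * Real.cos b| ≤ 1 := by
  rw [abs_mul]
  exact mul_le_one₀ (Real.abs_cos_le_one a) (abs_nonneg _) (Real.abs_cos_le_one b)

theorem cosKernel₁_eq_tsum (hα : 1 / 2 < α) (x y : I) :
    cosKernel₁ α γ x y =
      ∑' h : ℤ, r α γ h * (Real.cos (Real.pi * h * x) * Real.cos (Real.pi * h * y)) := by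
  set f : ℤ → ℝ := fun h =>
    r α γ h * (Real.cos (Real.pi * h * x) * Real.cos (Real.pi * h * y)) with hf
  have hsum : Summable f := by
    refine Summable.of_norm_bounded (summable_r (γ := γ) hα).abs fun h => ?_
    rw [hf, norm_mul]
    exact mul_le_of_le_one_right (abs_nonneg _) (abs_cos_mul_cos_le_one _ _)
  have hneg (h : ℤ) : f (-h) = f h := by simp [hf, r_neg]
  have hpos : Summable fun k : ℕ => f (k + 1) :=
    hsum.comp_injective (i := fun k : ℕ => (k : ℤ) + 1) fun a b h => by simpa using h
  have hterm (k : ℕ) : r α γ ((k : ℤ) + 1) * (√2 * Real.cos (Real.pi * (k + 1) * x)) *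
      (√2 * Real.cos (Real.pi * (k + 1) * y)) = 2 * f (k + 1) := by
    have hsqrt : √(2 : ℝ) * √2 = 2 := Real.mul_self_sqrt (by norm_num)
    simp only [hf, Int.cast_add, Int.cast_natCast, Int.cast_one]
    linear_combination (r α γ ((k : ℤ) + 1) *
      (Real.cos (Real.pi * (k + 1) * x) * Real.cos (Real.pi * (k + 1) * y))) * hsqrt
  rw [tsum_of_add_one_of_neg_add_one hpos (by simpa only [hneg] using hpos), cosKernel₁]
  simp only [hterm, hneg, tsum_mul_left]
  simp only [hf, r_zero, Int.cast_zero, mul_zero, zero_mul, Real.cos_zero, mul_one]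
  ring

theorem continuous_korKernel₁ (hα : 1 / 2 < α) :
    Continuous fun p : I × I => korKernel₁ α γ p.1 p.2 := by
  simp only [korKernel₁_eq_tsum hα]
  exact continuous_tsum_mul (summable_r hα) (fun h => by fun_prop)
    fun h p => Real.abs_cos_le_one _

theorem continuous_cosKernel₁ (hα : 1 / 2 < α) :
    Continuous fun p : I × I => cosKernel₁ α γ p.1 p.2 := by
  simp only [cosKernel₁_eq_tsum hα]
  exact continuous_tsum_mul (summable_r hα) (fun h => by fun_prop)
    fun h p => abs_cos_mul_cos_le_one _ _

theorem integral_korKernel₁ (hα : 1 / 2 < α) (x : I) : ∫ y, korKernel₁ α γ x y = 1 := by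
  simp only [korKernel₁_eq_tsum hα]
  rw [integral_tsum_mul (summable_r hα)
    (fun h => Continuous.aestronglyMeasurable (by fun_prop)) fun h y => Real.abs_cos_le_one _,
    tsum_eq_single 0 fun h hh => by rw [integral_cos_two_pi_mul_sub hh, mul_zero]]
  simp [r_zero]

theorem integral_cosKernel₁ (hα : 1 / 2 < α) (x : I) : ∫ y, cosKernel₁ α γ x y = 1 := by
  simp only [cosKernel₁_eq_tsum hα]
  rw [integral_tsum_mul (summable_r hα)
    (fun h => Continuous.aestronglyMeasurable (by fun_prop)) fun h y => abs_cos_mul_cos_le_one _ _,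
    tsum_eq_single 0 fun h hh => by rw [integral_cos_mul_cos_pi_mul hh, mul_zero]]
  simp [r_zero]

theorem cos_mul_tent (k : ℤ) (x : I) :
    Real.cos (Real.pi * k * (tent x : ℝ)) = Real.cos (2 * Real.pi * k * x) := by
  simp only [tent]
  rcases le_total 0 (2 * (x : ℝ) - 1) with h | h
  · rw [abs_of_nonneg h, ← Real.cos_neg, ← Real.cos_add_int_mul_two_pi _ k]
    ring_nf
  · rw [abs_of_nonpos h]
    ring_nf

theorem cosKernel₁_tent (hα : 1 / 2 < α) (x y : I) :
    cosKernel₁ α γ (tent x) (tent y) = ∑' h : ℤ, r α γ h *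
      (Real.cos (2 * Real.pi * h * x) * Real.cos (2 * Real.pi * h * y)) := by
  simp only [cosKernel₁_eq_tsum hα, cos_mul_tent]

theorem continuous_prod_kernel {ι X : Type*} [Fintype ι] [TopologicalSpace X] {K : ι → X → X → ℝ}
    (hK : ∀ j, Continuous fun p : X × X => K j p.1 p.2) :
    Continuous fun p : (ι → X) × (ι → X) => ∏ j, K j (p.1 j) (p.2 j) :=
  continuous_finsetProd _ fun j _ => (hK j).comp (g := fun p : X × X => K j p.1 p.2)
    (f := fun p : (ι → X) × (ι → X) => (p.1 j, p.2 j)) (by fun_prop)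

theorem integral_prod_kernel {ι X : Type*} [Fintype ι] [MeasureSpace X]
    [SigmaFinite (volume : Measure X)] {K : ι → X → X → ℝ}
    (hK : ∀ j x, ∫ y, K j x y = 1) (x : ι → X) : ∫ y : ι → X, ∏ j, K j (x j) (y j) = 1 := by
  rw [integral_fintype_prod_volume_eq_prod fun j t => K j (x j) t]
  simp only [hK, Finset.prod_const_one]

end Kernels

section Residues

theorem rpow_sum_le_sum_rpow {ι : Type*} (t : Finset ι) {f : ι → ℝ} (hf : ∀ i ∈ t, 0 ≤ f i)
    {p : ℝ} (hp : 0 < p) (hp1 : p ≤ 1) : (∑ i ∈ t, f i) ^ p ≤ ∑ i ∈ t, f i ^ p :=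
  Finset.le_sum_of_subadditive_on_pred (· ^ p) (0 ≤ ·) (Real.zero_rpow hp.ne').le
    (fun _ _ hx hy => Real.rpow_add_le_add_rpow hx hy hp.le hp1) (fun _ _ => add_nonneg) f hf

theorem rpow_tsum_le_tsum_rpow {ι : Type*} {f : ι → ℝ} (hf : ∀ i, 0 ≤ f i) {p : ℝ}
    (hp : 0 < p) (hp1 : p ≤ 1) (hs : Summable f) (hsp : Summable fun i => f i ^ p) :
    (∑' i, f i) ^ p ≤ ∑' i, f i ^ p :=
  le_of_tendsto_of_tendsto' (hs.hasSum.rpow_const (Or.inr hp.le)) hsp.hasSum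
    fun t => rpow_sum_le_sum_rpow t (fun i _ => hf i) hp hp1

variable {N : ℕ} {f : ℤ → ℝ}

/-- The periodization `c ↦ ∑_{h ≡ c mod N} f h` of `f` to a function on the residues. -/
def residueSum (N : ℕ) (f : ℤ → ℝ) (c : ZMod N) : ℝ :=
  ∑' h : ℤ, if (h : ZMod N) = c then f h else 0

theorem summable_ite_intCast_eq (hf : Summable f) (c : ZMod N) :
    Summable fun h : ℤ => if (h : ZMod N) = c then f h else 0 :=
  (hf.indicator {h : ℤ | (h : ZMod N) = c}).congr fun h => by
    simp only [Set.indicator_apply, Set.mem_ofPred_eq]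

theorem residueSum_nonneg (hf : ∀ h, 0 ≤ f h) (c : ZMod N) : 0 ≤ residueSum N f c :=
  tsum_nonneg fun h => ite_nonneg (hf h) le_rfl

theorem residueSum_neg (hf : ∀ h, f (-h) = f h) (c : ZMod N) :
    residueSum N f (-c) = residueSum N f c := by
  unfold residueSum
  rw [← (Equiv.neg ℤ).tsum_eq]
  simp only [Equiv.neg_apply, Int.cast_neg, neg_inj, hf]

theorem residueSum_rpow_le (hf : ∀ h, 0 ≤ f h) (hs : Summable f) {p : ℝ} (hp : 0 < p)
    (hp1 : p ≤ 1) (hsp : Summable fun h => f h ^ p) (c : ZMod N) :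
    residueSum N f c ^ p ≤ residueSum N (fun h => f h ^ p) c := by
  have hite (h : ℤ) : (if (h : ZMod N) = c then f h else 0) ^ p =
      if (h : ZMod N) = c then f h ^ p else 0 := by
    rw [apply_ite (· ^ p), Real.zero_rpow hp.ne']
  have hsubadd := rpow_tsum_le_tsum_rpow
    (f := fun h : ℤ => if (h : ZMod N) = c then f h else 0) (fun h => ite_nonneg (hf h) le_rfl)
    hp hp1 (summable_ite_intCast_eq hs c) (by simpa only [hite] using summable_ite_intCast_eq hsp c)
  simpa only [residueSum, hite] using hsubadd

theorem sum_residueSum_mul [NeZero N] (hf : Summable f) (F : ZMod N → ℝ) :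
    ∑ c, residueSum N f c * F c = ∑' h : ℤ, f h * F h := by
  have hfiber (c : ZMod N) := (summable_ite_intCast_eq hf c).hasSum.mul_right (F c)
  refine ((hasSum_sum fun c _ => hfiber c).tsum_eq.symm.trans (tsum_congr fun h => ?_))
  simp only [ite_mul, zero_mul, Finset.sum_ite_eq, Finset.mem_univ, if_true]

variable {α γ : ℝ}

theorem summable_mul_abs_rpow (hα : 1 / 2 < α) (γ : ℝ) :
    Summable fun h : ℤ => γ * |(h : ℝ)| ^ (-(2 * α)) :=
  (Real.summable_abs_int_rpow (by linarith)).mul_left γ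

theorem r_eq_ite_add (hα : α ≠ 0) (h : ℤ) :
    r α γ h = (if h = 0 then 1 else 0) + γ * |(h : ℝ)| ^ (-(2 * α)) := by
  rcases eq_or_ne h 0 with rfl | hh
  · simp [r, Real.zero_rpow, hα]
  · simp [r, hh]

theorem mul_abs_rpow_rpow (hγ : 0 ≤ γ) (p : ℝ) (h : ℤ) :
    (γ * |(h : ℝ)| ^ (-(2 * α))) ^ p = γ ^ p * |(h : ℝ)| ^ (-(2 * (α * p))) := by
  rw [Real.mul_rpow hγ (by positivity), ← Real.rpow_mul (abs_nonneg _)]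
  ring_nf

theorem r_rpow (hγ : 0 ≤ γ) (p : ℝ) (h : ℤ) : r α γ h ^ p = r (α * p) (γ ^ p) h := by
  rw [r, r, apply_ite (· ^ p), Real.one_rpow, mul_abs_rpow_rpow hγ]

theorem residueSum_r (hα : 1 / 2 < α) (c : ZMod N) :
    residueSum N (r α γ) c =
      (if c = 0 then 1 else 0) + residueSum N (fun h => γ * |(h : ℝ)| ^ (-(2 * α))) c := by
  have hsplit := ((hasSum_ite_eq (0 : ℤ) (if (0 : ZMod N) = c then (1 : ℝ) else 0)).add
    (summable_ite_intCast_eq (summable_mul_abs_rpow hα γ) c).hasSum).tsum_eq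
  simp only [eq_comm (a := c), residueSum, ← hsplit]
  refine tsum_congr fun h => ?_
  rw [r_eq_ite_add (by linarith)]
  rcases eq_or_ne h 0 with rfl | hh
  · split_ifs <;> simp_all
  · simp only [hh, if_false, zero_add]

theorem zetaReal_eq_tsum {a : ℝ} (ha : 1 < a) : zetaReal a = ∑' n : ℕ, (n : ℝ) ^ (-a) := by
  have hcast (n : ℕ) : 1 / (n : ℂ) ^ (a : ℂ) = (((n : ℝ) ^ (-a) : ℝ) : ℂ) := by
    rw [Real.rpow_neg n.cast_nonneg, Complex.ofReal_inv, Complex.ofReal_cpow n.cast_nonneg,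
      one_div, Complex.ofReal_natCast]
  rw [zetaReal, zeta_eq_tsum_one_div_nat_cpow (by simpa using ha)]
  simp only [hcast, ← Complex.ofReal_tsum, Complex.ofReal_re]

theorem zetaReal_pos {a : ℝ} (ha : 1 < a) : 0 < zetaReal a := by
  rw [zetaReal_eq_tsum ha]
  exact (Real.summable_nat_rpow.mpr (by linarith)).tsum_pos (fun n => by positivity) 1 (by simp)

theorem tsum_abs_rpow_neg {a : ℝ} (ha : 1 < a) :
    ∑' h : ℤ, |(h : ℝ)| ^ (-a) = 2 * zetaReal a := by
  have hsum : Summable fun n : ℕ => (n : ℝ) ^ (-a) := Real.summable_nat_rpow.mpr (by linarith)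
  rw [tsum_int_eq_zero_add_two_mul_tsum_pnat (fun h => by simp)
    (Real.summable_abs_int_rpow ha), zetaReal_eq_tsum ha, ← tsum_zero_pnat_eq_tsum_nat hsum]
  simp [Real.zero_rpow (by linarith : -a ≠ 0)]

theorem sum_residueSum_r [NeZero N] (hα : 1 / 2 < α) :
    ∑ c, residueSum N (r α γ) c = 1 + 2 * zetaReal (2 * α) * γ := by
  have htail := sum_residueSum_mul (N := N) (summable_mul_abs_rpow hα γ) fun _ => 1
  simp only [mul_one, tsum_mul_left, tsum_abs_rpow_neg (by linarith : 1 < 2 * α)] at htail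
  simp only [residueSum_r hα, Finset.sum_add_distrib, htail, Finset.sum_ite_eq',
    Finset.mem_univ, if_true]
  ring

end Residues

section DualWeight

variable {ι R : Type*} [Fintype ι] [DecidableEq ι] [Fintype R] [DecidableEq R]

/-- The total weight `∏ j, ρ j (c j)` of the frequencies `c` with `c ⬝ᵥ z = x`. For `x = 0` these
are the frequencies in the dual lattice of `z`. -/
def dualWeight [NonUnitalNonAssocSemiring R] (ρ : ι → R → ℝ) (z : ι → R) (x : R) : ℝ :=
  ∑ c : ι → R with c ⬝ᵥ z = x, ∏ j, ρ j (c j)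

section Semiring

variable [NonUnitalNonAssocSemiring R] {ρ ρ' : ι → R → ℝ}

theorem sum_dualWeight (ρ : ι → R → ℝ) (z : ι → R) :
    ∑ x, dualWeight ρ z x = ∏ j, ∑ c, ρ j c := by
  simp only [dualWeight]
  rw [Finset.sum_fiberwise, Finset.prod_univ_sum, Fintype.piFinset_univ]

theorem dualWeight_nonneg (hρ : ∀ j c, 0 ≤ ρ j c) (z : ι → R) (x : R) : 0 ≤ dualWeight ρ z x :=
  Finset.sum_nonneg fun c _ => Finset.prod_nonneg fun j _ => hρ j (c j)

theorem abs_dualWeight_le (h : ∀ j c, |ρ' j c| ≤ ρ j c) (z : ι → R) (x : R) :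
    |dualWeight ρ' z x| ≤ dualWeight ρ z x := by
  refine (Finset.abs_sum_le_sum_abs _ _).trans (Finset.sum_le_sum fun c _ => ?_)
  rw [Finset.abs_prod]
  exact Finset.prod_le_prod (fun j _ => abs_nonneg _) fun j _ => h j (c j)

theorem dualWeight_rpow_le (hρ : ∀ j c, 0 ≤ ρ j c) {p : ℝ} (hp : 0 < p) (hp1 : p ≤ 1)
    (h : ∀ j c, ρ j c ^ p ≤ ρ' j c) (z : ι → R) (x : R) :
    dualWeight ρ z x ^ p ≤ dualWeight ρ' z x := by
  refine (rpow_sum_le_sum_rpow _ (fun c _ => Finset.prod_nonneg fun j _ => hρ j (c j)) hp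
    hp1).trans (Finset.sum_le_sum fun c _ => ?_)
  rw [← Real.finsetProd_rpow _ _ fun j _ => hρ j (c j)]
  exact Finset.prod_le_prod (fun j _ => Real.rpow_nonneg (hρ j (c j)) p) fun j _ => h j (c j)

end Semiring

theorem dualWeight_fin_zero [NonUnitalNonAssocSemiring R] (ρ : Fin 0 → R → ℝ) (z : Fin 0 → R) :
    dualWeight ρ z 0 = 1 := by
  simp [dualWeight]

theorem dualWeight_fin_succ [Ring R] {d : ℕ} (ρ : Fin (d + 1) → R → ℝ) (z : Fin (d + 1) → R)
    (x : R) :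
    dualWeight ρ z x = ∑ b, ρ (Fin.last d) b *
      dualWeight (Fin.init ρ) (Fin.init z) (x - b * z (Fin.last d)) := by
  simp only [dualWeight, Finset.sum_filter, Finset.mul_sum]
  rw [← (Fin.snocEquiv fun _ : Fin (d + 1) => R).sum_comp, Fintype.sum_prod_type]
  refine Finset.sum_congr rfl fun b _ => Finset.sum_congr rfl fun c _ => ?_
  simp only [Fin.snocEquiv, Equiv.coe_fn_mk, dotProduct, Fin.sum_univ_castSucc,
    Fin.prod_univ_castSucc, Fin.snoc_castSucc, Fin.snoc_last, eq_sub_iff_add_eq, Fin.init,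
    mul_comm (ρ _ b), ite_mul, zero_mul]

theorem dualWeight_mul_le [Ring R] {d : ℕ} {ρ ψ : Fin (d + 1) → R → ℝ} {θ : R → ℝ}
    (hρ : ∀ j c, 0 ≤ Fin.init ρ j c) (hθ : ∀ b, 0 ≤ θ b)
    (hlast : ∀ b, ρ (Fin.last d) b = (if b = 0 then 1 else 0) + θ b)
    (hψ : ∀ j c, |ψ j c| ≤ 1) (hψ0 : ψ (Fin.last d) 0 = 1) (z : Fin (d + 1) → R) :
    dualWeight (fun j c => ρ j c * ψ j c) z 0 ≤
      dualWeight (fun j c => Fin.init ρ j c * Fin.init ψ j c) (Fin.init z) 0 +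
        ∑ b, θ b * dualWeight (Fin.init ρ) (Fin.init z) (-(b * z (Fin.last d))) := by
  set X := dualWeight (fun j c => Fin.init ρ j c * Fin.init ψ j c) (Fin.init z)
  set Y := dualWeight (Fin.init ρ) (Fin.init z)
  have hXY (x : R) : |X x| ≤ Y x := abs_dualWeight_le (fun j c => by
    rw [abs_mul, abs_of_nonneg (hρ j c)]
    exact mul_le_of_le_one_right (hρ j c) (hψ j.castSucc c)) _ x
  have hterm (b : R) (x : R) : θ b * ψ (Fin.last d) b * X x ≤ θ b * Y x := by
    rw [mul_assoc]
    refine mul_le_mul_of_nonneg_left ((le_abs_self _).trans ?_) (hθ b)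
    rw [abs_mul]
    exact (mul_le_of_le_one_left (abs_nonneg _) (hψ _ b)).trans (hXY x)
  have hzero : ∑ b, (if b = 0 then 1 else 0) * ψ (Fin.last d) b * X (-(b * z (Fin.last d))) =
      X 0 := by
    simp [hψ0]
  rw [dualWeight_fin_succ, ← hzero, ← Finset.sum_add_distrib]
  refine Finset.sum_le_sum fun b _ => ?_
  rw [hlast, zero_sub, add_mul, add_mul]
  exact add_le_add_right (hterm b _) _

end DualWeight

section Characters

variable {N : ℕ} [NeZero N]

/-- The function `x ↦ cos (2 π x / N)` on the residues modulo `N`. -/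
def charCos (x : ZMod N) : ℝ := (ZMod.stdAddChar x).re

theorem charCos_intCast (j : ℤ) : charCos (j : ZMod N) = Real.cos (2 * Real.pi * j / N) := by
  rw [charCos, ZMod.stdAddChar_coe, ← Complex.exp_ofReal_mul_I_re]
  push_cast
  ring_nf

theorem charCos_zero : charCos (0 : ZMod N) = 1 := by
  rw [charCos, AddChar.map_zero_eq_one, Complex.one_re]

theorem charCos_neg (x : ZMod N) : charCos (-x) = charCos x := by
  rw [charCos, AddChar.map_neg_eq_conj, Complex.conj_re, charCos]

theorem abs_charCos_le (x : ZMod N) : |charCos x| ≤ 1 := by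
  obtain ⟨j, rfl⟩ := ZMod.intCast_surjective x
  exact charCos_intCast (N := N) j ▸ Real.abs_cos_le_one _

theorem sum_even_mul_charCos {F : ZMod N → ℝ} (hF : ∀ c, F (-c) = F c) (a : ZMod N) :
    ((∑ c, F c * charCos (c * a) : ℝ) : ℂ) = ∑ c, (F c : ℂ) * ZMod.stdAddChar (c * a) := by
  have hodd : ∑ c, F c * (ZMod.stdAddChar (c * a)).im = 0 := by
    refine self_eq_neg.mp ?_
    rw [← Finset.sum_neg_distrib, ← Equiv.sum_comp (Equiv.neg (ZMod N))]
    simp only [Equiv.neg_apply, hF, neg_mul, AddChar.map_neg_eq_conj, Complex.conj_im, mul_neg]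
  apply Complex.ext
  · simp [charCos]
  · simpa using hodd.symm

theorem prod_stdAddChar_mul {ι : Type*} [Fintype ι] (c z : ι → ZMod N) (n : ZMod N) :
    ∏ j, ZMod.stdAddChar (c j * (n * z j)) = ZMod.stdAddChar (n * c ⬝ᵥ z) := by
  rw [dotProduct, Finset.mul_sum]
  simp only [mul_left_comm _ n]
  exact (map_prod (ZMod.stdAddChar (N := N)).toMonoidHom
    (fun j => Multiplicative.ofAdd (n * (c j * z j))) Finset.univ).symm

theorem sum_prod_sum_mul_charCos {ι : Type*} [Fintype ι] [DecidableEq ι] {ρ : ι → ZMod N → ℝ}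
    (hρ : ∀ j c, ρ j (-c) = ρ j c) (z : ι → ZMod N) :
    ∑ n : ZMod N, ∏ j, ∑ c, ρ j c * charCos (c * (n * z j)) = N * dualWeight ρ z 0 := by
  have horthogonality (x : ZMod N) :
      ∑ n : ZMod N, (ZMod.stdAddChar (n * x) : ℂ) = if x = 0 then (N : ℂ) else 0 := by
    simpa [ZMod.card] using AddChar.sum_mulShift x (ZMod.isPrimitive_stdAddChar N)
  have hexpand (n : ZMod N) : ((∏ j, ∑ c, ρ j c * charCos (c * (n * z j)) : ℝ) : ℂ) =
      ∑ c : ι → ZMod N, (∏ j, (ρ j (c j) : ℂ)) * ZMod.stdAddChar (n * c ⬝ᵥ z) := by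
    simp only [Complex.ofReal_prod, sum_even_mul_charCos (hρ _)]
    simp only [Finset.prod_univ_sum, Fintype.piFinset_univ, Finset.prod_mul_distrib,
      prod_stdAddChar_mul]
  apply Complex.ofReal_injective
  rw [Complex.ofReal_sum, Finset.sum_congr rfl fun n _ => hexpand n, Finset.sum_comm]
  simp only [← Finset.mul_sum, horthogonality, mul_ite, mul_zero, ← Finset.sum_filter,
    ← Finset.sum_mul, dualWeight]
  push_cast
  exact mul_comm _ _

end Characters

section SquaredError

variable {N s : ℕ} {α : ℝ}

theorem coe_latticePoints (g : Fin s → ℕ) (n : Fin N) (j : Fin s) :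
    (latticePoints g N n j : ℝ) =
      (((n : ℕ) * g j : ℤ) : ℝ) / N - (⌊((n : ℕ) : ℝ) * g j / N⌋ : ℤ) := by
  simp only [latticePoints, Int.fract]
  push_cast
  rfl

variable [NeZero N]

theorem cos_two_pi_mul_eq_charCos {t : ℝ} {k l : ℤ} (ht : t = k / N - l) (h : ℤ) :
    Real.cos (2 * Real.pi * h * t) = charCos (N := N) (h * k) := by
  rw [← Int.cast_mul, charCos_intCast, ← Real.cos_add_int_mul_two_pi _ (h * l), ht]
  push_cast
  ring_nf

theorem cos_latticePoints (g : Fin s → ℕ) (n : Fin N) (j : Fin s) (h : ℤ) :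
    Real.cos (2 * Real.pi * h * latticePoints g N n j) =
      charCos (N := N) (h * ((n : ℕ) * g j)) := by
  rw [cos_two_pi_mul_eq_charCos (coe_latticePoints g n j)]
  push_cast
  rfl

theorem cos_latticePoints_sub (g : Fin s → ℕ) (n m : Fin N) (j : Fin s) (h : ℤ) :
    Real.cos (2 * Real.pi * h * ((latticePoints g N n j : ℝ) - latticePoints g N m j)) =
      charCos (N := N) (h * (((n : ℕ) - (m : ℕ)) * g j)) := by
  rw [cos_two_pi_mul_eq_charCos (N := N) (k := ((n : ℕ) - (m : ℕ)) * g j)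
    (l := ⌊((n : ℕ) : ℝ) * g j / N⌋ - ⌊((m : ℕ) : ℝ) * g j / N⌋)]
  · push_cast
    rfl
  · rw [coe_latticePoints, coe_latticePoints]
    push_cast
    ring

theorem korKernel₁_latticePoints (hα : 1 / 2 < α) (γ : ℝ) (g : Fin s → ℕ) (n m : Fin N)
    (j : Fin s) :
    korKernel₁ α γ (latticePoints g N n j) (latticePoints g N m j) =
      ∑ c, residueSum N (r α γ) c * charCos (N := N) (c * (((n : ℕ) - (m : ℕ)) * g j)) := by
  rw [korKernel₁_eq_tsum hα, sum_residueSum_mul (summable_r hα)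
    fun c : ZMod N => charCos (N := N) (c * (((n : ℕ) - (m : ℕ)) * g j))]
  simp only [cos_latticePoints_sub]

theorem cosKernel₁_tentLatticePoints (hα : 1 / 2 < α) (γ : ℝ) (g : Fin s → ℕ) (n m : Fin N)
    (j : Fin s) :
    cosKernel₁ α γ (tentLatticePoints g N n j) (tentLatticePoints g N m j) =
      ∑ c, residueSum N (r α γ) c * charCos (N := N) (c * ((m : ℕ) * g j)) *
        charCos (N := N) (c * ((n : ℕ) * g j)) := by
  simp only [mul_assoc (residueSum N (r α γ) _)]
  rw [tentLatticePoints, tentLatticePoints, cosKernel₁_tent hα, sum_residueSum_mul (summable_r hα)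
    fun c : ZMod N => charCos (N := N) (c * ((m : ℕ) * g j)) *
      charCos (N := N) (c * ((n : ℕ) * g j))]
  exact tsum_congr fun h => by rw [cos_latticePoints, cos_latticePoints, mul_comm (charCos _)]

theorem sum_fin_natCast {E : Type*} [AddCommMonoid E] (f : ZMod N → E) :
    ∑ n : Fin N, f (n : ℕ) = ∑ n, f n :=
  Fintype.sum_bijective (fun n : Fin N => ((n : ℕ) : ZMod N))
    ((Fintype.bijective_iff_injective_and_card _).mpr ⟨fun a b hab => Fin.ext <| by
      rwa [ZMod.natCast_eq_natCast_iff', Nat.mod_eq_of_lt a.2, Nat.mod_eq_of_lt b.2] at hab,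
      by simp [ZMod.card]⟩) _ _ fun _ => rfl

/-- The total weight of the dual lattice of `z`, damped by the products of the values
`φ (c j * (m * z j))` and averaged over `m`. With `φ = 1` and `φ = charCos` it describes the
errors of lattice rules and of tent-transformed lattice rules, respectively. -/
def meanDualWeight {ι : Type*} [Fintype ι] [DecidableEq ι] (φ : ZMod N → ℝ) (ρ : ι → ZMod N → ℝ)
    (z : ι → ZMod N) : ℝ :=
  (1 / N) * ∑ m, dualWeight (fun j c => ρ j c * φ (c * (m * z j))) z 0

/-- The squared worst-case error of the rule with generating vector `g`: of the lattice rule in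
the Korobov space for `φ = 1`, and of the tent-transformed rule in the half-period cosine space
for `φ = charCos`. -/
def squaredError (φ : ZMod N → ℝ) (α : ℝ) (γ : Fin s → ℝ) (g : Fin s → ℕ) : ℝ :=
  meanDualWeight φ (fun j => residueSum N (r α (γ j))) (fun j => (g j : ZMod N)) - 1

theorem average_korKernel (hα : 1 / 2 < α) (γ : Fin s → ℝ) (g : Fin s → ℕ) :
    1 / (N : ℝ) ^ 2 * ∑ n, ∑ m, korKernel α γ (latticePoints g N n) (latticePoints g N m) =
      meanDualWeight (fun _ => 1) (fun j => residueSum N (r α (γ j)))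
        (fun j => (g j : ZMod N)) := by
  have hN : (N : ℝ) ≠ 0 := by exact_mod_cast NeZero.ne N
  simp only [korKernel, korKernel₁_latticePoints hα]
  rw [Finset.sum_comm, meanDualWeight, ← sum_fin_natCast, Finset.mul_sum, Finset.mul_sum]
  refine Finset.sum_congr rfl fun m _ => ?_
  rw [sum_fin_natCast fun n : ZMod N => ∏ j, ∑ c, residueSum N (r α (γ j)) c *
      charCos (N := N) (c * ((n - (m : ℕ)) * g j)),
    ← Equiv.sum_comp (Equiv.addRight ((m : ℕ) : ZMod N))]
  simp only [Equiv.coe_addRight, add_sub_cancel_right]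
  rw [sum_prod_sum_mul_charCos fun j => residueSum_neg r_neg]
  simp only [mul_one]
  field_simp

theorem average_cosKernel (hα : 1 / 2 < α) (γ : Fin s → ℝ) (g : Fin s → ℕ) :
    1 / (N : ℝ) ^ 2 * ∑ n, ∑ m,
        cosKernel α γ (tentLatticePoints g N n) (tentLatticePoints g N m) =
      meanDualWeight charCos (fun j => residueSum N (r α (γ j))) (fun j => (g j : ZMod N)) := by
  have hN : (N : ℝ) ≠ 0 := by exact_mod_cast NeZero.ne N
  simp only [cosKernel, cosKernel₁_tentLatticePoints hα]
  rw [Finset.sum_comm, meanDualWeight, ← sum_fin_natCast, Finset.mul_sum, Finset.mul_sum]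
  refine Finset.sum_congr rfl fun m _ => ?_
  rw [sum_fin_natCast fun n : ZMod N => ∏ j, ∑ c, residueSum N (r α (γ j)) c *
      charCos (N := N) (c * ((m : ℕ) * g j)) * charCos (N := N) (c * (n * g j)),
    sum_prod_sum_mul_charCos fun j c => by
      rw [residueSum_neg r_neg, neg_mul, charCos_neg]]
  field_simp

theorem korError_eq_sqrt (hα : 1 / 2 < α) {γ : Fin s → ℝ} (hγ : ∀ j, 0 < γ j) (g : Fin s → ℕ) :
    0 ≤ squaredError (N := N) (fun _ => 1) α γ g ∧
    korError N hα hγ g = ENNReal.ofReal √(squaredError (N := N) (fun _ => 1) α γ g) := by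
  rw [squaredError, ← average_korKernel hα]
  exact worstCaseError_eq (NeZero.ne N) (isPSDKernel_korKernel hα hγ)
    (continuous_prod_kernel fun j => continuous_korKernel₁ hα)
    (integral_prod_kernel fun j => integral_korKernel₁ hα) (latticePoints g N)

theorem cosError_eq_sqrt (hα : 1 / 2 < α) {γ : Fin s → ℝ} (hγ : ∀ j, 0 < γ j) (g : Fin s → ℕ) :
    0 ≤ squaredError (N := N) charCos α γ g ∧
    cosError N hα hγ g = ENNReal.ofReal √(squaredError (N := N) charCos α γ g) := by
  rw [squaredError, ← average_cosKernel hα]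
  exact worstCaseError_eq (NeZero.ne N) (isPSDKernel_cosKernel hα hγ)
    (continuous_prod_kernel fun j => continuous_cosKernel₁ hα)
    (integral_prod_kernel fun j => integral_cosKernel₁ hα) (tentLatticePoints g N)

theorem squaredError_le_squaredError_one {φ : ZMod N → ℝ} (hφ : ∀ x, |φ x| ≤ 1) {γ : Fin s → ℝ}
    (hγ : ∀ j, 0 < γ j) (g : Fin s → ℕ) :
    squaredError φ α γ g ≤ squaredError (N := N) (fun _ => 1) α γ g := by
  refine sub_le_sub_right (mul_le_mul_of_nonneg_left (Finset.sum_le_sum fun m _ => ?_)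
    (by positivity)) 1
  refine (le_abs_self _).trans (abs_dualWeight_le (fun j c => ?_) _ _)
  have hρ := residueSum_nonneg (r_nonneg (α := α) (hγ j)) c
  rw [abs_mul, abs_of_nonneg hρ]
  exact mul_le_mul_of_nonneg_left (hφ _) hρ

theorem squaredError_fin_zero (φ : ZMod N → ℝ) (γ : Fin 0 → ℝ) (g : Fin 0 → ℕ) :
    squaredError φ α γ g = 0 := by
  have hN : (N : ℝ) ≠ 0 := by exact_mod_cast NeZero.ne N
  simp [squaredError, meanDualWeight, dualWeight_fin_zero, ZMod.card, hN]

end SquaredError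

section Increment

variable {N : ℕ} {α : ℝ}

/-- The total weight of the frequencies that an additional component `g` with weight `γ'`
contributes to the dual lattice of `z`: those whose new entry is nonzero. -/
def dualWeightIncrement {ι : Type*} [Fintype ι] [DecidableEq ι] [NeZero N] (α : ℝ) (γ : ι → ℝ)
    (γ' : ℝ) (z : ι → ZMod N) (g : ZMod N) : ℝ :=
  ∑ b, residueSum N (fun h => γ' * |(h : ℝ)| ^ (-(2 * α))) b *
    dualWeight (fun j => residueSum N (r α (γ j))) z (-(b * g))

variable [NeZero N]

theorem squaredError_le_add_increment (hα : 1 / 2 < α) {φ : ZMod N → ℝ} (hφ : ∀ x, |φ x| ≤ 1)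
    (hφ0 : φ 0 = 1) {d : ℕ} {γ : Fin (d + 1) → ℝ} (hγ : ∀ j, 0 < γ j) (g : Fin (d + 1) → ℕ) :
    squaredError φ α γ g ≤ squaredError φ α (Fin.init γ) (Fin.init g) +
      dualWeightIncrement α (Fin.init γ) (γ (Fin.last d)) (fun j => (Fin.init g j : ZMod N))
        (g (Fin.last d)) := by
  have hN : (N : ℝ) ≠ 0 := by exact_mod_cast NeZero.ne N
  have hdual (m : ZMod N) := dualWeight_mul_le
    (ρ := fun j => residueSum N (r α (γ j))) (ψ := fun j c => φ (c * (m * g j)))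
    (fun j => residueSum_nonneg (r_nonneg (hγ j.castSucc)))
    (residueSum_nonneg fun h => mul_nonneg (hγ (Fin.last d)).le (by positivity))
    (residueSum_r hα) (fun j c => hφ _) (by simp only [zero_mul, hφ0]) fun j => (g j : ZMod N)
  have hsum := Finset.sum_le_sum fun m (_ : m ∈ Finset.univ) => hdual m
  have hmean := mul_le_mul_of_nonneg_left hsum (by positivity : 0 ≤ 1 / (N : ℝ))
  rw [Finset.sum_add_distrib, Finset.sum_const, Finset.card_univ, ZMod.card, nsmul_eq_mul, mul_add,
    one_div, inv_mul_cancel_left₀ hN, ← one_div] at hmean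
  rw [squaredError, squaredError, sub_add_eq_add_sub]
  exact sub_le_sub_right hmean 1

section Existence

variable {ι : Type*} [Fintype ι] [DecidableEq ι] {γ : ι → ℝ} {γ' p : ℝ}

theorem dualWeightIncrement_nonneg (hγ : ∀ j, 0 < γ j) (hγ' : 0 < γ') (z : ι → ZMod N)
    (g : ZMod N) : 0 ≤ dualWeightIncrement α γ γ' z g :=
  Finset.sum_nonneg fun b _ => mul_nonneg
    (residueSum_nonneg (fun h => mul_nonneg hγ'.le (by positivity)) b)
    (dualWeight_nonneg (fun j => residueSum_nonneg (r_nonneg (hγ j))) _ _)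

theorem dualWeightIncrement_rpow_le (hα : 1 / 2 < α) (hγ : ∀ j, 0 < γ j) (hγ' : 0 < γ')
    (hp : 1 / 2 < α * p) (hp0 : 0 < p) (hp1 : p ≤ 1) (z : ι → ZMod N) (g : ZMod N) :
    dualWeightIncrement α γ γ' z (-g) ^ p ≤ γ' ^ p * multiplesSum (2 * (α * p))
      (dualWeight (fun j => residueSum N (r (α * p) (γ j ^ p))) z) g := by
  have hθ (h : ℤ) : 0 ≤ γ' * |(h : ℝ)| ^ (-(2 * α)) := mul_nonneg hγ'.le (by positivity)
  have hρ (j : ι) := residueSum_nonneg (N := N) (r_nonneg (α := α) (hγ j))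
  have hWρ (x : ZMod N) := dualWeight_nonneg hρ z x
  have hW (x : ZMod N) : dualWeight (fun j => residueSum N (r α (γ j))) z x ^ p ≤
      dualWeight (fun j => residueSum N (r (α * p) (γ j ^ p))) z x :=
    dualWeight_rpow_le hρ hp0 hp1 (fun j c => by
      simpa only [r_rpow (hγ j).le] using residueSum_rpow_le (r_nonneg (hγ j)) (summable_r hα) hp0
        hp1 (by simpa only [r_rpow (hγ j).le] using summable_r hp) c) z x
  have hθp (b : ZMod N) := residueSum_rpow_le hθ (summable_mul_abs_rpow hα γ') hp0 hp1
    (by simpa only [mul_abs_rpow_rpow hγ'.le] using summable_mul_abs_rpow hp (γ' ^ p)) b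
  simp only [mul_abs_rpow_rpow hγ'.le] at hθp
  calc dualWeightIncrement α γ γ' z (-g) ^ p
      ≤ ∑ b, (residueSum N (fun h => γ' * |(h : ℝ)| ^ (-(2 * α))) b *
          dualWeight (fun j => residueSum N (r α (γ j))) z (b * g)) ^ p := by
        simp only [dualWeightIncrement, mul_neg, neg_neg]
        exact rpow_sum_le_sum_rpow _ (fun b _ => mul_nonneg (residueSum_nonneg hθ b) (hWρ _))
          hp0 hp1
    _ ≤ ∑ b, residueSum N (fun h => γ' ^ p * |(h : ℝ)| ^ (-(2 * (α * p)))) b *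
          dualWeight (fun j => residueSum N (r (α * p) (γ j ^ p))) z (b * g) := by
        refine Finset.sum_le_sum fun b _ => ?_
        rw [Real.mul_rpow (residueSum_nonneg hθ b) (hWρ _)]
        exact mul_le_mul (hθp b) (hW _) (Real.rpow_nonneg (hWρ _) p)
          ((Real.rpow_nonneg (residueSum_nonneg hθ b) p).trans (hθp b))
    _ = γ' ^ p * multiplesSum (2 * (α * p))
          (dualWeight (fun j => residueSum N (r (α * p) (γ j ^ p))) z) g := by
        rw [sum_residueSum_mul (summable_mul_abs_rpow hp _) fun b =>
          dualWeight (fun j => residueSum N (r (α * p) (γ j ^ p))) z (b * g)]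
        simp only [multiplesSum, mul_assoc, tsum_mul_left]

theorem exists_dualWeightIncrement_rpow_le [Nontrivial (ZMod N)] (hα : 1 / 2 < α)
    (hγ : ∀ j, 0 < γ j) (hγ' : 0 < γ') (hp : 1 / 2 < α * p) (hp0 : 0 < p) (hp1 : p ≤ 1)
    (z : ι → ZMod N) :
    ∃ n ∈ Finset.Icc 1 (N - 1), ((N : ℝ) - 1) * dualWeightIncrement α γ γ' z (n : ℕ) ^ p ≤
      2 * zetaReal (2 * (α * p)) * γ' ^ p *
        ∏ j, (1 + 2 * zetaReal (2 * (α * p)) * γ j ^ p) := by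
  have hN : 0 ≤ (N : ℝ) - 1 := sub_nonneg.mpr (by exact_mod_cast NeZero.one_le)
  obtain ⟨g, hg0, hg⟩ := exists_ne_zero_multiplesSum_le (a := 2 * (α * p)) (by linarith)
    (dualWeight_nonneg (fun j => residueSum_nonneg (r_nonneg
      (α := α * p) (Real.rpow_pos_of_pos (hγ j) p))) z)
  rw [tsum_abs_rpow_neg (by linarith), sum_dualWeight] at hg
  simp only [sum_residueSum_r hp] at hg
  refine ⟨(-g).val, Finset.mem_Icc.mpr ⟨?_, Nat.le_sub_one_of_lt (ZMod.val_lt _)⟩, ?_⟩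
  · exact Nat.one_le_iff_ne_zero.mpr ((ZMod.val_ne_zero _).mpr (neg_ne_zero.mpr hg0))
  · rw [ZMod.natCast_zmod_val]
    refine (mul_le_mul_of_nonneg_left
      (dualWeightIncrement_rpow_le hα hγ hγ' hp hp0 hp1 z g) hN).trans ?_
    rw [mul_left_comm, mul_comm (2 * _), mul_assoc]
    exact mul_le_mul_of_nonneg_left hg (Real.rpow_nonneg hγ'.le p)

end Existence

end Increment

section ComponentByComponent

variable {s N : ℕ}

theorem IsCBC.mem_Icc {err : (d : ℕ) → d ≤ s → (Fin d → ℕ) → ℝ≥0∞} {g : Fin s → ℕ}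
    (hg : IsCBC s N err g) (j : Fin s) : 1 ≤ g j ∧ g j ≤ N - 1 :=
  Finset.mem_Icc.mp (hg j j.2).1

theorem exists_isCBC (hN : 2 ≤ N) {s : ℕ} (err : (d : ℕ) → d ≤ s → (Fin d → ℕ) → ℝ≥0∞) :
    ∃ g, IsCBC s N err g := by
  induction s with
  | zero => exact ⟨Fin.elim0, fun d hd => absurd hd d.not_lt_zero⟩
  | succ s ih =>
    obtain ⟨g, hg⟩ := ih fun d h => err d (h.trans s.le_succ)
    obtain ⟨n, hn, hmin⟩ := (Finset.Icc 1 (N - 1)).exists_min_image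
      (fun n => err (s + 1) le_rfl (Fin.snoc (α := fun _ => ℕ) g n))
      (Finset.nonempty_Icc.mpr (Nat.le_sub_one_of_lt hN))
    have hprefix (d : ℕ) (hd : d ≤ s) : (fun i => Fin.snoc (α := fun _ => ℕ) g n
        (Fin.castLE (hd.trans s.le_succ) i)) = fun i => g (Fin.castLE hd i) :=
      funext fun i => Fin.snoc_castSucc (α := fun _ => ℕ) n g (Fin.castLE hd i)
    refine ⟨Fin.snoc g n, fun d hd => ?_⟩
    rcases Nat.lt_succ_iff_lt_or_eq.mp hd with hds | rfl
    · have hcomponent : Fin.snoc (α := fun _ => ℕ) g n ⟨d, hd⟩ = g ⟨d, hds⟩ :=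
        Fin.snoc_castSucc (α := fun _ => ℕ) n g ⟨d, hds⟩
      rw [hcomponent, hprefix d hds.le, hprefix (d + 1) hds]
      exact hg d hds
    · have hlast : Fin.snoc (α := fun _ => ℕ) g n ⟨d, hd⟩ = n :=
        Fin.snoc_last (α := fun _ => ℕ) n g
      rw [hlast, hprefix d le_rfl]
      exact ⟨hn, hmin⟩

variable [NeZero N] {α : ℝ} {γ : Fin s → ℝ} {g : Fin s → ℕ}

theorem exists_squaredError_snoc_le [Nontrivial (ZMod N)] (hα : 1 / 2 < α) {φ : ZMod N → ℝ}
    (hφ : ∀ x, |φ x| ≤ 1) (hφ0 : φ 0 = 1) {d : ℕ} {γ : Fin (d + 1) → ℝ} (hγ : ∀ j, 0 < γ j)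
    {p : ℝ} (hp : 1 / 2 < α * p) (hp0 : 0 < p) (hp1 : p ≤ 1) (g : Fin d → ℕ) :
    ∃ n ∈ Finset.Icc 1 (N - 1), ∃ T, 0 ≤ T ∧
      squaredError φ α γ (Fin.snoc (α := fun _ => ℕ) g n) ≤
        squaredError φ α (Fin.init γ) g + T ∧
      ((N : ℝ) - 1) * T ^ p ≤ 2 * zetaReal (2 * (α * p)) * γ (Fin.last d) ^ p *
        ∏ j, (1 + 2 * zetaReal (2 * (α * p)) * Fin.init γ j ^ p) := by
  have hγinit (j : Fin d) : 0 < Fin.init γ j := hγ j.castSucc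
  obtain ⟨n, hn, hle⟩ := exists_dualWeightIncrement_rpow_le (N := N) hα hγinit (hγ (Fin.last d))
    hp hp0 hp1 fun j => (g j : ZMod N)
  refine ⟨n, hn, _, dualWeightIncrement_nonneg hγinit (hγ (Fin.last d)) _ _, ?_, hle⟩
  simpa only [Fin.init_snoc, Fin.snoc_last] using
    squaredError_le_add_increment hα hφ hφ0 hγ (Fin.snoc (α := fun _ => ℕ) g n)

theorem IsCBC.squaredError_rpow_le [Nontrivial (ZMod N)] (hα : 1 / 2 < α) (hγ : ∀ j, 0 < γ j)
    {φ : ZMod N → ℝ} (hφ : ∀ x, |φ x| ≤ 1) (hφ0 : φ 0 = 1)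
    {err : (d : ℕ) → d ≤ s → (Fin d → ℕ) → ℝ≥0∞}
    (herr : ∀ d (h : d ≤ s) z, 0 ≤ squaredError φ α (fun j => γ (Fin.castLE h j)) z ∧
      err d h z = ENNReal.ofReal √(squaredError φ α (fun j => γ (Fin.castLE h j)) z))
    (hg : IsCBC s N err g) {p : ℝ} (hp : 1 / 2 < α * p) (hp0 : 0 < p) (hp1 : p ≤ 1) :
    ((N : ℝ) - 1) * squaredError φ α γ g ^ p ≤
      ∏ j, (1 + 2 * zetaReal (2 * (α * p)) * γ j ^ p) - 1 := by
  have hN : 0 ≤ (N : ℝ) - 1 := sub_nonneg.mpr (by exact_mod_cast NeZero.one_le)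
  suffices hprefix : ∀ d (h : d ≤ s), ((N : ℝ) - 1) *
      squaredError φ α (fun j => γ (Fin.castLE h j)) (fun j => g (Fin.castLE h j)) ^ p ≤
        ∏ j, (1 + 2 * zetaReal (2 * (α * p)) * γ (Fin.castLE h j) ^ p) - 1 from
    hprefix s le_rfl
  intro d
  induction d with
  | zero => simp [squaredError_fin_zero, Real.zero_rpow hp0.ne']
  | succ d ih =>
    intro hd
    obtain ⟨n, hn, T, hT, hsnoc, hTp⟩ := exists_squaredError_snoc_le hα hφ hφ0
      (fun j => hγ (Fin.castLE hd j)) hp hp0 hp1 fun j => g (Fin.castLE (Nat.le_of_lt hd) j)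
    obtain ⟨hnonneg, heq⟩ := herr (d + 1) hd fun i => g (Fin.castLE hd i)
    obtain ⟨hnonneg', heq'⟩ := herr (d + 1) hd
      (Fin.snoc (α := fun _ => ℕ) (fun j => g (Fin.castLE (Nat.le_of_lt hd) j)) n)
    have hmin := (hg d hd).2 n hn
    rw [heq, heq', ENNReal.ofReal_le_ofReal_iff (Real.sqrt_nonneg _),
      Real.sqrt_le_sqrt_iff hnonneg'] at hmin
    have hinit := (herr d (Nat.le_of_lt hd) fun j => g (Fin.castLE (Nat.le_of_lt hd) j)).1
    have hpow := mul_le_mul_of_nonneg_left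
      ((Real.rpow_le_rpow hnonneg (hmin.trans hsnoc) hp0.le).trans
        (Real.rpow_add_le_add_rpow hinit hT hp0.le hp1)) hN
    rw [mul_add] at hpow
    refine (hpow.trans (add_le_add (ih (Nat.le_of_lt hd)) hTp)).trans_eq ?_
    rw [Fin.prod_univ_castSucc]
    simp only [Fin.init, Fin.castLE_castSucc]
    ring

end ComponentByComponent

section Bound

variable {s : ℕ} {α τ : ℝ} {γ : Fin s → ℝ}

theorem boundConst_eq (hγ : ∀ j, 0 < γ j) (τ : ℝ) :
    boundConst α γ τ =
      (-1 + ∏ j, (1 + 2 * zetaReal (2 * α / τ) * γ j ^ (1 / τ))) ^ (τ / 2) := by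
  rw [boundConst, Finset.prod_one_add, Finset.powerset_univ,
    ← Finset.add_sum_erase _ _ (Finset.mem_univ ∅), Finset.prod_empty, neg_add_cancel_left]
  congr 1
  refine Finset.sum_congr (by ext u; simp [Finset.nonempty_iff_ne_empty]) fun u _ => ?_
  rw [Finset.prod_mul_distrib, Finset.prod_const, ← Real.finsetProd_rpow _ _ fun j _ => (hγ j).le,
    mul_comm]

theorem one_lt_prod_one_add_zetaReal (hs : s ≠ 0) (hτ : 0 < τ) (hτα : τ < 2 * α)
    (hγ : ∀ j, 0 < γ j) : 1 < ∏ j, (1 + 2 * zetaReal (2 * α / τ) * γ j ^ (1 / τ)) := by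
  have : NeZero s := ⟨hs⟩
  have hζ : 0 < zetaReal (2 * α / τ) := zetaReal_pos ((one_lt_div hτ).mpr hτα)
  have hfactor (j : Fin s) : 1 < 1 + 2 * zetaReal (2 * α / τ) * γ j ^ (1 / τ) :=
    lt_add_of_pos_right 1 (mul_pos (mul_pos two_pos hζ) (Real.rpow_pos_of_pos (hγ j) _))
  simpa using Finset.prod_lt_prod_of_nonempty (f := fun _ : Fin s => (1 : ℝ))
    (fun _ _ => one_pos) (fun j _ => hfactor j) ⟨0, Finset.mem_univ _⟩

theorem boundConst_pos (hs : s ≠ 0) (hτ : 0 < τ) (hτα : τ < 2 * α) (hγ : ∀ j, 0 < γ j) :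
    0 < boundConst α γ τ := by
  rw [boundConst_eq hγ]
  exact Real.rpow_pos_of_pos
    (lt_neg_add_iff_lt.mpr (one_lt_prod_one_add_zetaReal hs hτ hτα hγ)) _

theorem sqrt_le_rpow_mul_rpow_of_mul_rpow_le {E B M τ : ℝ} (hE : 0 ≤ E) (hM : 0 < M)
    (hτ : 0 < τ) (h : M * E ^ (1 / τ) ≤ B) : √E ≤ B ^ (τ / 2) * M ^ (-τ / 2) := by
  have hroot : 0 ≤ E ^ (1 / τ) := Real.rpow_nonneg hE _
  calc √E = (E ^ (1 / τ)) ^ (τ / 2) := by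
        rw [← Real.rpow_mul hE, Real.sqrt_eq_rpow]
        field_simp
    _ ≤ (B / M) ^ (τ / 2) := Real.rpow_le_rpow hroot ((le_div_iff₀' hM).mpr h) (by linarith)
    _ = B ^ (τ / 2) * M ^ (-τ / 2) := by
        rw [Real.div_rpow ((mul_nonneg hM.le hroot).trans h) hM.le, neg_div, Real.rpow_neg hM.le,
          div_eq_mul_inv]

variable {N : ℕ} {g : Fin s → ℕ}

theorem IsCBC.cosError_le [NeZero N] (hN : 2 ≤ N) (hα : 1 / 2 < α)
    (hγ : ∀ j, 0 < γ j) {φ : ZMod N → ℝ} (hφ : ∀ x, |φ x| ≤ 1) (hφ0 : φ 0 = 1)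
    {err : (d : ℕ) → d ≤ s → (Fin d → ℕ) → ℝ≥0∞}
    (herr : ∀ d (h : d ≤ s) z, 0 ≤ squaredError φ α (fun j => γ (Fin.castLE h j)) z ∧
      err d h z = ENNReal.ofReal √(squaredError φ α (fun j => γ (Fin.castLE h j)) z))
    (hcos : squaredError (N := N) charCos α γ g ≤ squaredError φ α γ g)
    (hg : IsCBC s N err g) (hτ : 1 ≤ τ) (hτα : τ < 2 * α) :
    cosError N hα hγ g ≤ ENNReal.ofReal (boundConst α γ τ * ((N : ℝ) - 1) ^ (-τ / 2)) := by
  have hτ0 : 0 < τ := one_pos.trans_le hτ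
  have : Fact (1 < N) := ⟨hN⟩
  have hM : 0 < (N : ℝ) - 1 := sub_pos.mpr (by exact_mod_cast hN)
  have hpow := hg.squaredError_rpow_le hα hγ hφ hφ0 herr (p := 1 / τ)
    (by rwa [mul_one_div, lt_div_iff₀ hτ0, one_div_mul_eq_div, div_lt_iff₀' two_pos])
    (one_div_pos.mpr hτ0) ((div_le_one hτ0).mpr hτ)
  rw [mul_one_div, ← mul_div_assoc, sub_eq_neg_add (∏ j, _)] at hpow
  obtain ⟨hnonneg, heq⟩ := cosError_eq_sqrt (N := N) hα hγ g
  rw [heq, boundConst_eq hγ]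
  refine ENNReal.ofReal_le_ofReal ((Real.sqrt_le_sqrt hcos).trans ?_)
  exact sqrt_le_rpow_mul_rpow_of_mul_rpow_le (hnonneg.trans hcos) hM hτ0 hpow

theorem IsKorCBC.cosError_le (hN : 2 ≤ N) (hα : 1 / 2 < α) (hγ : ∀ j, 0 < γ j)
    (hg : IsKorCBC N hα hγ g) (hτ : 1 ≤ τ) (hτα : τ < 2 * α) :
    cosError N hα hγ g ≤ ENNReal.ofReal (boundConst α γ τ * ((N : ℝ) - 1) ^ (-τ / 2)) :=
  have : NeZero N := ⟨by lia⟩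
  IsCBC.cosError_le hN hα hγ (φ := fun _ => 1) (fun _ => abs_one.le) rfl
    (fun _ h => korError_eq_sqrt hα fun j => hγ (Fin.castLE h j))
    (squaredError_le_squaredError_one abs_charCos_le hγ g) hg hτ hτα

theorem IsCosCBC.cosError_le (hN : 2 ≤ N) (hα : 1 / 2 < α) (hγ : ∀ j, 0 < γ j)
    (hg : IsCosCBC N hα hγ g) (hτ : 1 ≤ τ) (hτα : τ < 2 * α) :
    cosError N hα hγ g ≤ ENNReal.ofReal (boundConst α γ τ * ((N : ℝ) - 1) ^ (-τ / 2)) :=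
  have : NeZero N := ⟨by lia⟩
  IsCBC.cosError_le hN hα hγ abs_charCos_le charCos_zero
    (fun _ h => cosError_eq_sqrt hα fun j => hγ (Fin.castLE h j)) le_rfl hg hτ hτα

end Bound

end TentLattice

end

theorem mainTheorem4 (s N : ℕ) (hs : 1 ≤ s) (hN : 2 ≤ N) (α : ℝ) (hα : 1 / 2 < α)
    (γ : Fin s → ℝ) (hγ : ∀ j, 0 < γ j) :
    (∃ g : Fin s → ℕ, TentLattice.IsKorCBC N hα hγ g) ∧
    (∃ g : Fin s → ℕ, TentLattice.IsCosCBC N hα hγ g) ∧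
    (∀ g : Fin s → ℕ, TentLattice.IsKorCBC N hα hγ g ∨ TentLattice.IsCosCBC N hα hγ g →
      (∀ j, 1 ≤ g j ∧ g j ≤ N - 1) ∧
      ∀ τ : ℝ, 1 ≤ τ → τ < 2 * α →
        TentLattice.cosError N hα hγ g ≤
          ENNReal.ofReal (TentLattice.boundConst α γ τ * ((N : ℝ) - 1) ^ (-τ / 2))) ∧
    (∀ τ : ℝ, 1 ≤ τ → τ < 2 * α →
      0 < TentLattice.boundConst α γ τ ∧
      TentLattice.boundConst α γ τ =
        (-1 + ∏ j, (1 + 2 * TentLattice.zetaReal (2 * α / τ) * γ j ^ (1 / τ))) ^ (τ / 2)) := by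
  have hs0 : s ≠ 0 := Nat.one_le_iff_ne_zero.mp hs
  refine ⟨TentLattice.exists_isCBC hN _, TentLattice.exists_isCBC hN _, fun g hg =>
    ⟨?_, fun τ hτ hτα => ?_⟩, fun τ hτ hτα => ⟨?_, TentLattice.boundConst_eq hγ τ⟩⟩
  · exact hg.elim TentLattice.IsCBC.mem_Icc TentLattice.IsCBC.mem_Icc
  · rcases hg with hkor | hcos
    · exact hkor.cosError_le hN hα hγ hτ hτα
    · exact hcos.cosError_le hN hα hγ hτ hτα
  · exact TentLattice.boundConst_pos hs0 (one_pos.trans_le hτ) hτα hγ
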